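/- Let $1\le k\le N$ be integers, $n=\lceil N/k\rceil$ and $\ell=nk-N$, so that $0\le \ell<k$. \emph{Matrices.} $\mathcal J_{k,N}$ is the set of Hermitian block tridiagonal matrices $J\in\mathbb C^{N\times N}$ with diagonal blocks $A_0,\dots,A_{n-1}$, subdiagonal blocks $B_0,\dots,B_{n-2}$ and superdiagonal blocks $B_0^*,\dots,B_{n-2}^*$, where $A_0,\dots,A_{n-2}\in\mathbb C^{k\times k}$ and $A_{n-1}\in\mathbb C^{(k-\ell)\times(k-\ell)}$ are Hermitian, $B_0,\dots,B_{n-3}\in\mathbb C^{k\times k}$ are upper triangular with positive diagonal entries, and $B_{n-2}\in\mathbb C^{(k-\ell)\times k}$ has full rank and is in row echelon form with positive pivots. For $J\in\mathcal J_{k,N}$ with eigenvalues $\lambda_1,\dots,\lambda_N$ and a corresponding orthonormal basis of eigenvectors, let $v_j\in\mathbb C^k$ be the vector of the first $k$ components of the $j$-th eigenvector, and put $$\varphi(J)=\sum_{j=1}^N v_jv_j^*\,\delta_{\lambda_j}.$$ \emph{Measures.} For a $k\times k$ matrix-valued measure $\mu$ on $\mathbb R$ and matrix polynomials $F,G$ with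 $k$ rows, let $\langle F,G\rangle_\mu=\int F(x)^*\mu(dx)G(x)$, and let $\mathcal N_d$ be the space of polynomials $p$ of degree at most $d$ with coefficients in $\mathbb C^k$ such that $\langle p,p\rangle_\mu=0$. Let $\mathcal M_{k,N}$ be the set of measures $\mu=\sum_{j=1}^m W_j\delta_{x_j}$ with distinct $x_j\in\mathbb R$, positive semidefinite $W_j\in\mathbb C^{k\times k}$, $\sum_j W_j=I_k$, $\sum_j\operatorname{rank}W_j=N$, $\dim\mathcal N_d=0$ for $0\le d<n-1$, and $\dim\mathcal N_{n-1}=\ell$. \emph{Recurrence coefficients.} Let $\mu\in\mathcal M_{k,N}$, let $\Pi_0,\dots,\Pi_{n-1}$ be the monic matrix orthogonal polynomials of $\mu$ ($\deg\Pi_j=j$, leading coefficient $I_k$, $\langle\Pi_i,\Pi_j\rangle_\mu=0$ for $i\ne j$), and $\gamma_j=\langle\Pi_j,\Pi_j\rangle_\mu$. Put $P_0=I_k$ and, for $1\le j\le n-2$, $P_j=\Pi_j\gamma_j^{-1/2}Q_j$, where the unitary matrices $Q_j$ are chosen so that $B_j=\langle P_{j+1},xP_j\rangle_\mu$ is upper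 triangular with positive diagonal entries for $0\le j\le n-3$. If $n\ge2$, put $$P=xP_{n-2}-P_{n-2}A_{n-2}-P_{n-3}B_{n-3}^*,\qquad A_{n-2}=\langle P_{n-2},xP_{n-2}\rangle_\mu$$ (with $P_{-1}=0$), let $B_{n-2}\in\mathbb C^{(k-\ell)\times k}$ be in row echelon form with positive pivots such that $\langle P,P\rangle_\mu=B_{n-2}^*B_{n-2}$, and put $P_{n-1}=PB_{n-2}^\dagger$, where $B_{n-2}^\dagger=B_{n-2}^*(B_{n-2}B_{n-2}^*)^{-1}$. Finally let $A_j=\langle P_j,xP_j\rangle_\mu$ for $0\le j\le n-1$. \textbf{Theorem.} For every $\mu\in\mathcal M_{k,N}$ the coefficients $A_0,\dots,A_{n-1}$, $B_0,\dots,B_{n-2}$ exist and are unique, so that the block tridiagonal matrix $\psi(\mu)\in\mathbb C^{N\times N}$ with these diagonal and subdiagonal blocks (and superdiagonal blocks $B_j^*$) is well defined; moreover $\psi(\mu)\in\mathcal J_{k,N}$ and $\varphi(\psi(\mu))=\mu$. Consequently $\varphi$ is a bijection from $\mathcal J_{k,N}$ onto $\mathcal M_{k,N}$, with inverse $\psi$.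 -/

import Mathlib

open MeasureTheory Polynomial Matrix
open scoped ComplexOrder

noncomputable section

namespace BandedSpectral

/-! ### Block structure of `N × N` matrices with blocks of size `k` -/

/-- The number of diagonal blocks, `n = ⌈N / k⌉`. -/
def numBlocks (k N : ℕ) : ℕ := N ⌈/⌉ k

/-- The defect `ℓ = n k - N` of the last block. -/
def defect (k N : ℕ) : ℕ := numBlocks k N * k - N

/-- The size of the `j`-th block (counted from `0`): it is `k` for `j < n - 1`, and
`k - ℓ = N - (n - 1) k` for `j = n - 1`. -/
def blockSize (k N j : ℕ) : ℕ := min k (N - j * k)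

theorem blockSize_le (k N j : ℕ) : blockSize k N j ≤ k := min_le_left _ _

/-- The position in `{0, …, N - 1}` of the `a`-th index of the `j`-th block. -/
def blockIndex (k N j : ℕ) (a : Fin (blockSize k N j)) : Fin N :=
  ⟨j * k + a, by
    have h := a.isLt
    unfold blockSize at h
    have h2 : (a : ℕ) < N - j * k := lt_of_lt_of_le h (min_le_right _ _)
    omega⟩

/-- The block selection matrix: the columns of the `N × N` identity that belong to block `j`. -/
def blockSel (k N j : ℕ) : Matrix (Fin N) (Fin (blockSize k N j)) ℂ :=
  (1 : Matrix (Fin N) (Fin N) ℂ).submatrix id (blockIndex k N j)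

/-- The `N × N` block tridiagonal matrix with diagonal blocks `A 0, …, A (n-1)`, subdiagonal
blocks `B 0, …, B (n-2)` and superdiagonal blocks `(B 0)ᴴ, …, (B (n-2))ᴴ`. Only the entries of the
two families with these indices are used. -/
def blockTridiag (k N : ℕ)
    (A : ∀ j, Matrix (Fin (blockSize k N j)) (Fin (blockSize k N j)) ℂ)
    (B : ∀ j, Matrix (Fin (blockSize k N (j + 1))) (Fin (blockSize k N j)) ℂ) :
    Matrix (Fin N) (Fin N) ℂ :=
  ∑ j ∈ Finset.range (numBlocks k N), blockSel k N j * A j * (blockSel k N j)ᴴ +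
  ∑ j ∈ Finset.range (numBlocks k N - 1),
    (blockSel k N (j + 1) * B j * (blockSel k N j)ᴴ +
      blockSel k N j * (B j)ᴴ * (blockSel k N (j + 1))ᴴ)

/-- Upper triangular with positive diagonal entries. -/
def IsUpperTriangularPos {r s : ℕ} (M : Matrix (Fin r) (Fin s) ℂ) : Prop :=
  (∀ (a : Fin r) (b : Fin s), (b : ℕ) < (a : ℕ) → M a b = 0) ∧
  (∀ (a : Fin r) (b : Fin s), (a : ℕ) = (b : ℕ) → 0 < M a b)

/-- Row echelon form with positive pivots. -/
def IsRowEchelonPos {r s : ℕ} (M : Matrix (Fin r) (Fin s) ℂ) : Prop :=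
  M.IsRowEchelon ∧ ∀ i c, M.IsLeadingEntry i c → 0 < M i c

/-- The class `𝒥_{k,N}` of banded Hermitian matrices. -/
def bandedClass (k N : ℕ) : Set (Matrix (Fin N) (Fin N) ℂ) :=
  {J | ∃ (A : ∀ j, Matrix (Fin (blockSize k N j)) (Fin (blockSize k N j)) ℂ)
      (B : ∀ j, Matrix (Fin (blockSize k N (j + 1))) (Fin (blockSize k N j)) ℂ),
      (∀ j, j < numBlocks k N → (A j).IsHermitian) ∧
      (∀ j, j + 1 < numBlocks k N → (B j).rank = blockSize k N (j + 1)) ∧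
      (∀ j, j + 2 < numBlocks k N → IsUpperTriangularPos (B j)) ∧
      (∀ j, j + 2 = numBlocks k N → IsRowEchelonPos (B j)) ∧
      J = blockTridiag k N A B}

/-! ### Matrix-valued measures and the quasi-inner product -/

/-- `k × k` complex matrix-valued (countably additive) Borel set functions on `ℝ`. -/
abbrev MatMeasure (k : ℕ) : Type := VectorMeasure ℝ (Matrix (Fin k) (Fin k) ℂ)

/-- The complex measure `μ_{ab}` given by the `(a, b)` entry of a matrix-valued measure. -/
def entryMeasure {k : ℕ} (μ : MatMeasure k) (a b : Fin k) : ComplexMeasure ℝ :=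
  μ.mapRange (Matrix.entryAddMonoidHom ℂ a b) (continuous_id.matrix_elem a b)

/-- The right quasi-inner product `⟨F, G⟩_μ = ∫ F(x)ᴴ μ(dx) G(x)` of matrix polynomials,
written entrywise. Matrix polynomials with `r` columns are `k × r` matrices over `ℂ[X]`. -/
def quasiInner {k r s : ℕ} (μ : MatMeasure k)
    (F : Matrix (Fin k) (Fin r) ℂ[X]) (G : Matrix (Fin k) (Fin s) ℂ[X]) :
    Matrix (Fin r) (Fin s) ℂ :=
  Matrix.of fun i j => ∑ a, ∑ b,
    (entryMeasure μ a b).integral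
      (fun x : ℝ => star ((F a i).eval (x : ℂ)) * (G b j).eval (x : ℂ))
      (ContinuousLinearMap.mul ℝ ℂ)

/-- The set `𝒩_d` of vector polynomials `p` of degree at most `d` with `⟨p, p⟩_μ = 0`. -/
def nullPolys {k : ℕ} (μ : MatMeasure k) (d : ℕ) : Set (Fin k → ℂ[X]) :=
  {p | (∀ a, (p a).natDegree ≤ d) ∧
    quasiInner μ (Matrix.replicateCol (Fin 1) p) (Matrix.replicateCol (Fin 1) p) = 0}

/-- The set `ℳ_{k,N}`: measures `∑_{x ∈ s} W x δ_x` over a finite set `s` of reals with positive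
semidefinite weights, total mass `I`, total rank `N`, and `dim 𝒩_d = 0` for `d < n - 1`,
`dim 𝒩_{n-1} = ℓ`. For a positive semidefinite measure `𝒩_d` is a linear subspace, so that
`Set.finrank`, the dimension of the linear span, is its dimension. -/
def measureClass (k N : ℕ) : Set (MatMeasure k) :=
  {μ | (∃ (s : Finset ℝ) (W : ℝ → Matrix (Fin k) (Fin k) ℂ),
      μ = ∑ x ∈ s, VectorMeasure.dirac x (W x) ∧
      (∀ x ∈ s, (W x).PosSemidef) ∧
      ∑ x ∈ s, W x = 1 ∧
      ∑ x ∈ s, (W x).rank = N) ∧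
    (∀ d, d + 1 < numBlocks k N → Set.finrank ℂ (nullPolys μ d) = 0) ∧
    (∀ d, d + 1 = numBlocks k N → Set.finrank ℂ (nullPolys μ d) = defect k N)}

/-! ### The spectral map `φ` -/

/-- The first `k` components of the `j`-th normalized eigenvector of a Hermitian matrix. -/
def eigenvectorHead {k N : ℕ} (hkN : k ≤ N) {J : Matrix (Fin N) (Fin N) ℂ}
    (hJ : J.IsHermitian) (j : Fin N) : Fin k → ℂ :=
  fun a => hJ.eigenvectorBasis j (Fin.castLE hkN a)

open Classical in
/-- The spectral map `φ(J) = ∑_j v_j v_jᴴ δ_{λ_j}`, for Hermitian `J` (all elements of `𝒥_{k,N}`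
are Hermitian; the value `0` for other matrices is never used). -/
def spectralMap {k N : ℕ} (hkN : k ≤ N) (J : Matrix (Fin N) (Fin N) ℂ) : MatMeasure k :=
  if hJ : J.IsHermitian then
    ∑ j, VectorMeasure.dirac (hJ.eigenvalues j)
      (Matrix.vecMulVec (eigenvectorHead hkN hJ j) (star (eigenvectorHead hkN hJ j)))
  else 0

/-! ### Orthogonal polynomials and the inverse spectral map `ψ` -/

/-- `Π 0, …, Π (n-1)` are monic `k × k` matrix polynomials, `Π j` of degree `j`, orthogonal with
respect to `μ`. -/
def IsMonicOrthogonal {k : ℕ} (μ : MatMeasure k) (n : ℕ)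
    (Pi : ℕ → Matrix (Fin k) (Fin k) ℂ[X]) : Prop :=
  (∀ j < n, (∀ a b, (Pi j a b).natDegree ≤ j) ∧ (Pi j).map (fun p => p.coeff j) = 1) ∧
  (∀ i < n, ∀ j < n, i ≠ j → quasiInner μ (Pi i) (Pi j) = 0)

/-- The right inverse `Bᴴ (B Bᴴ)⁻¹` (the Moore-Penrose pseudoinverse) of a matrix of full row
rank. -/
def rightInv {r s : ℕ} (B : Matrix (Fin r) (Fin s) ℂ) : Matrix (Fin s) (Fin r) ℂ :=
  Bᴴ * (B * Bᴴ)⁻¹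

/-- The polynomial `x P_j(x) - P_j(x) A_j - P_{j-1}(x) (B_{j-1})ᴴ`, with `P_{-1} = 0`. -/
def residual {k N : ℕ} (P : ∀ j, Matrix (Fin k) (Fin (blockSize k N j)) ℂ[X])
    (A : ∀ j, Matrix (Fin (blockSize k N j)) (Fin (blockSize k N j)) ℂ)
    (B : ∀ j, Matrix (Fin (blockSize k N (j + 1))) (Fin (blockSize k N j)) ℂ) :
    ∀ j, Matrix (Fin k) (Fin (blockSize k N j)) ℂ[X]
  | 0 => (X : ℂ[X]) • P 0 - P 0 * (A 0).map C
  | j + 1 => (X : ℂ[X]) • P (j + 1) - P (j + 1) * (A (j + 1)).map C - P j * (B j)ᴴ.map C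

/-- `P 0, …, P (n-1)` are the normalized orthonormal polynomials of `μ`, with recurrence
coefficients `A 0, …, A (n-1)` and `B 0, …, B (n-2)`. The blocks with index below `n - 1` have `k`
columns, and restricting columns along `Fin.castLE` is only a change of the index type there (and
for block `0` if `k ≤ N`). -/
structure IsNormalizedOPS (k N : ℕ) (μ : MatMeasure k)
    (P : ∀ j, Matrix (Fin k) (Fin (blockSize k N j)) ℂ[X])
    (A : ∀ j, Matrix (Fin (blockSize k N j)) (Fin (blockSize k N j)) ℂ)
    (B : ∀ j, Matrix (Fin (blockSize k N (j + 1))) (Fin (blockSize k N j)) ℂ) : Prop where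
  /-- `P_0 = I`. -/
  zero : P 0 = (1 : Matrix (Fin k) (Fin k) ℂ[X]).submatrix id (Fin.castLE (blockSize_le k N 0))
  /-- `P_j = Π_j γ_j^{-1/2} Q_j` with `Q_j` unitary, for `j ≤ n - 2`, where `Π_j` is the monic
  orthogonal polynomial and `γ_j = ⟨Π_j, Π_j⟩_μ`; `R` below is the positive definite square root
  of `γ_j`. -/
  normalization : ∃ Pi : ℕ → Matrix (Fin k) (Fin k) ℂ[X],
    IsMonicOrthogonal μ (numBlocks k N) Pi ∧
    ∀ j, j + 1 < numBlocks k N → ∃ R Q : Matrix (Fin k) (Fin k) ℂ,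
      R.PosDef ∧ R * R = quasiInner μ (Pi j) (Pi j) ∧ Q ∈ Matrix.unitaryGroup (Fin k) ℂ ∧
      P j = (Pi j * (R⁻¹ * Q).map C).submatrix id (Fin.castLE (blockSize_le k N j))
  /-- `A_j = ⟨P_j, x P_j⟩_μ` for `j ≤ n - 1`. -/
  diag : ∀ j, j < numBlocks k N → A j = quasiInner μ (P j) ((X : ℂ[X]) • P j)
  /-- `B_j = ⟨P_{j+1}, x P_j⟩_μ` for `j ≤ n - 3`. -/
  subdiag : ∀ j, j + 2 < numBlocks k N → B j = quasiInner μ (P (j + 1)) ((X : ℂ[X]) • P j)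
  /-- `B_j` is upper triangular with positive diagonal entries for `j ≤ n - 3`. -/
  subdiag_pos : ∀ j, j + 2 < numBlocks k N → IsUpperTriangularPos (B j)
  /-- `B_{n-2}` is in row echelon form with positive pivots. -/
  last_echelon : ∀ j, j + 2 = numBlocks k N → IsRowEchelonPos (B j)
  /-- `(B_{n-2})ᴴ B_{n-2} = ⟨P, P⟩_μ`, with `P` the polynomial `residual` of index `n - 2`. -/
  last_norm : ∀ j, j + 2 = numBlocks k N →
    quasiInner μ (residual P A B j) (residual P A B j) = (B j)ᴴ * B j
  /-- `P_{n-1} = P (B_{n-2})†`. -/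
  last_poly : ∀ j, j + 2 = numBlocks k N → P (j + 1) = residual P A B j * (rightInv (B j)).map C

/-- `J` is the block tridiagonal matrix of the recurrence coefficients of the normalized
orthonormal polynomials of `μ`. -/
def IsRecurrenceMatrix (k N : ℕ) (μ : MatMeasure k) (J : Matrix (Fin N) (Fin N) ℂ) : Prop :=
  ∃ P A B, IsNormalizedOPS k N μ P A B ∧ J = blockTridiag k N A B

/-- The inverse spectral map `ψ`: it sends `μ` to the matrix of its recurrence coefficients. -/
def inverseSpectralMap (k N : ℕ) (μ : MatMeasure k) : Matrix (Fin N) (Fin N) ℂ :=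
  Classical.epsilon (IsRecurrenceMatrix k N μ)

end BandedSpectral

end

/-! The proof replaces a measure by a finite-dimensional model. A pair `(T, E)`, with `T` of size `N
× N` and `E` of size `N × k`, models `μ` (`IsModel`) if `⟨F, G⟩_μ` is the Gram matrix of the values
`∑ Tⁱ E Fᵢ` and `∑ Tⁱ E Gᵢ` (`polyEval`). Unitary conjugation preserves models, and a model
determines a finitely supported measure (`sum_dirac_ext`). A sum of `N` rank one atoms has a
diagonal model; conjugating by the eigenvector matrix shows that `J` together with the first `k`
columns of the identity models `φ(J)` (`isModel_spectralMap`). In any model the null spaces `𝒩_d`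
are kernels of Krylov matrices, so the dimension conditions defining `ℳ` say that `(E, …, T^{n-2}
E)` has full column rank and `(E, …, T^{n-1} E)` has full row rank (`IsModel.finrank_nullPolys`).

For banded `J`, the three-term recurrence says exactly that the polynomial `P_j` evaluates to the
`j`-th block of columns of the identity (`polyEval_recPoly`). Hence the Krylov ranks are as
required, `φ(J)` lies in `ℳ`, and the `P_j` are normalized orthonormal polynomials with the blocks
of `J` as coefficients (`isNormalizedOPS_recPoly`). They evaluate to the same blocks for every other
normalized system as well (`IsNormalizedOPS.polyEval_eq`), because a row echelon matrix with
positive pivots is determined by its Gram matrix (`IsRowEchelonPos.eq_of_gram_eq`). So `J` is the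
only recurrence matrix of `φ(J)`, which makes `ψ` a left inverse of `φ`.

Surjectivity is a block Lanczos reduction: Gram-Schmidt applied to the Krylov columns of a diagonal
model of `μ` yields a unitary conjugation to a banded model (`exists_unitary_conj_mem_bandedClass`).
A left inverse together with surjectivity gives all the assertions. -/

noncomputable section

namespace BandedSpectral

/-! ### Echelon matrices and their Gram matrices -/

/-- Row echelon matrices with positive pivots are determined by their Gram matrices. -/
theorem IsRowEchelonPos.eq_of_gram_eq {r s : ℕ} {B B' : Matrix (Fin r) (Fin s) ℂ}
    (hB : IsRowEchelonPos B) (hB' : IsRowEchelonPos B') (h : Bᴴ * B = B'ᴴ * B') : B = B' := by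
  have gram : ∀ c' c, ∑ i, star (B i c') * B i c = ∑ i, star (B' i c') * B' i c := by
    intro c' c
    have := congrFun (congrFun h c') c
    simpa [Matrix.mul_apply] using this
  suffices H : ∀ c : Fin s, ∀ i : Fin r, B i c = B' i c by
    ext i c; exact H c i
  intro c
  -- The entries are compared column by column from the left and, within a column, from the top row
  -- down.
  induction c using WellFoundedLT.induction with
  | ind c ihc =>
  intro i
  induction i using WellFoundedLT.induction with
  | ind i ihi =>
  by_cases hz : ∀ c' < c, B i c' = 0
  -- The echelon shape kills column `c` below row `i`, and the rows above agree by induction. The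
  -- Gram entry `(c, c)` then fixes the modulus of the remaining entry, which is nonnegative: it is
  -- either zero or a pivot.
  · have hz' : ∀ c' < c, B' i c' = 0 := fun c' hc' => by rw [← ihc c' hc' i, hz c' hc']
    have low : ∀ i' > i, B i' c = 0 := fun i' hi' => hB.1 hi' hz
    have low' : ∀ i' > i, B' i' c = 0 := fun i' hi' => hB'.1 hi' hz'
    have nn : 0 ≤ B i c := by
      by_cases h0 : B i c = 0
      · exact h0.ge
      · exact (hB.2 i c ⟨hz, h0⟩).le
    have nn' : 0 ≤ B' i c := by
      by_cases h0 : B' i c = 0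
      · exact h0.ge
      · exact (hB'.2 i c ⟨hz', h0⟩).le
    have key : star (B i c) * B i c = star (B' i c) * B' i c := by
      have g := gram c c
      rw [← Finset.add_sum_erase _ _ (Finset.mem_univ i),
        ← Finset.add_sum_erase (a := i) _ _ (Finset.mem_univ i)] at g
      have : ∑ x ∈ Finset.univ.erase i, star (B x c) * B x c =
          ∑ x ∈ Finset.univ.erase i, star (B' x c) * B' x c := by
        refine Finset.sum_congr rfl fun x hx => ?_
        rcases lt_or_gt_of_ne (Finset.ne_of_mem_erase hx) with hlt | hgt
        · rw [ihi x hlt]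
        · rw [low x hgt, low' x hgt]
      rw [this] at g
      exact add_right_cancel g
    rw [Complex.nonneg_iff] at nn nn'
    have e : B i c = ((B i c).re : ℂ) := Complex.ext rfl (by simp [← nn.2])
    have e' : B' i c = ((B' i c).re : ℂ) := Complex.ext rfl (by simp [← nn'.2])
    rw [e, e'] at key ⊢
    simp only [Complex.star_def, Complex.conj_ofReal, ← Complex.ofReal_mul,
      Complex.ofReal_inj] at key ⊢
    exact (mul_self_inj_of_nonneg nn.1 nn'.1).1 key
  -- Here the pivot of row `i` sits in an earlier column `c'`, already known to agree. Column `c'`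
  -- vanishes below row `i`, so the Gram entry `(c', c)` determines `B i c` after cancelling the
  -- pivot.
  · have hne : ∃ c', c' < c ∧ B i c' ≠ 0 := by push Not at hz; exact hz
    obtain ⟨c', hc', hlead⟩ := row_ne_zero_iff_exists_isLeadingEntry.1
      (fun h0 : B i = 0 => hne.choose_spec.2 (congrFun h0 _))
    have hlt : c' < c := by
      by_contra hge
      obtain ⟨d, hd, hd0⟩ := hne
      exact hd0 (hc' d (lt_of_lt_of_le hd (not_lt.1 hge)))
    have hcol : ∀ x, B' x c' = B x c' := fun x => (ihc c' hlt x).symm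
    have low : ∀ x > i, B x c' = 0 := fun x hx => hB.1 hx hc'
    have g := gram c' c
    simp only [hcol] at g
    rw [← Finset.add_sum_erase _ _ (Finset.mem_univ i),
      ← Finset.add_sum_erase (a := i) _ _ (Finset.mem_univ i)] at g
    have : ∑ x ∈ Finset.univ.erase i, star (B x c') * B x c =
        ∑ x ∈ Finset.univ.erase i, star (B x c') * B' x c := by
      refine Finset.sum_congr rfl fun x hx => ?_
      rcases lt_or_gt_of_ne (Finset.ne_of_mem_erase hx) with hlt | hgt
      · rw [ihi x hlt]
      · rw [low x hgt]; simp
    rw [this] at g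
    exact mul_left_cancel₀ (star_ne_zero.2 hlead) (add_right_cancel g)

/-- `p` is the strictly increasing sequence of positions of the leading entries of the rows of
`M`, all of which are positive. -/
structure HasPivots {r s : ℕ} (M : Matrix (Fin r) (Fin s) ℂ) (p : Fin r → Fin s) : Prop where
  strictMono : StrictMono p
  zero : ∀ i c, c < p i → M i c = 0
  pos : ∀ i, 0 < M i (p i)

namespace HasPivots

variable {r s : ℕ} {M : Matrix (Fin r) (Fin s) ℂ} {p : Fin r → Fin s}

theorem isRowEchelonPos (h : HasPivots M p) : IsRowEchelonPos M := by
  refine ⟨fun i₁ i₂ hi c hc => h.zero _ _ ?_, fun i c hc => ?_⟩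
  · by_contra hlt
    exact (h.pos i₁).ne' (hc _ ((h.strictMono hi).trans_le (not_lt.1 hlt)))
  · have : c = p i := hc.unique ⟨fun j hj => h.zero i j hj, (h.pos i).ne'⟩
    rw [this]; exact h.pos i

theorem vecMul_injective (h : HasPivots M p) : Function.Injective (fun v => v ᵥ* M) := by
  have : ∀ v, v ᵥ* M = 0 → v = 0 := by
    intro v hv
    funext i
    induction i using WellFoundedLT.induction with
    | ind i ih =>
    have := congrFun hv (p i)
    -- Forward substitution: in column `p i` the rows after `i` are zero, and the coefficients
    -- before `i` vanish by induction.
    rw [Matrix.vecMul, dotProduct, Finset.sum_eq_single i] at this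
    · exact (mul_eq_zero.1 this).resolve_right (h.pos i).ne'
    · intro j _ hj
      rcases lt_or_gt_of_ne hj with hlt | hgt
      · rw [ih j hlt]; simp
      · rw [h.zero j (p i) (h.strictMono hgt)]; simp
    · simp
  intro v w hvw
  rw [← sub_eq_zero]
  apply this
  rw [Matrix.sub_vecMul]
  exact sub_eq_zero.2 hvw

theorem rank_eq (h : HasPivots M p) : M.rank = r := by
  have := (Matrix.vecMul_injective_iff.1 h.vecMul_injective).rank_matrix
  simpa using this

end HasPivots

theorem IsUpperTriangularPos.hasPivots {r s : ℕ} {M : Matrix (Fin r) (Fin s) ℂ} (hrs : r ≤ s)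
    (h : IsUpperTriangularPos M) : HasPivots M (Fin.castLE hrs) :=
  ⟨Fin.strictMono_castLE hrs, fun i c hc => h.1 i c hc, fun i => h.2 i _ rfl⟩

theorem mul_rightInv {r s : ℕ} {B : Matrix (Fin r) (Fin s) ℂ} (hB : B.rank = r) :
    B * rightInv B = 1 := by
  rw [rightInv, ← Matrix.mul_assoc]
  apply Matrix.mul_nonsing_inv
  rw [← Matrix.isUnit_iff_isUnit_det]
  have : (B * Bᴴ).rank = Fintype.card (Fin r) := by
    rw [rank_self_mul_conjTranspose, hB, Fintype.card_fin]
  rw [← Matrix.linearIndependent_rows_iff_isUnit, linearIndependent_iff_card_eq_finrank_span,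
    ← this, Matrix.rank_eq_finrank_span_row]
  rfl

/-! ### Evaluation of matrix polynomials at a matrix -/

section Eval

variable {k N r s : ℕ}

/-- The vector `∑ₐ pₐ(T) E eₐ`. -/
def vecEval (T : Matrix (Fin N) (Fin N) ℂ) (E : Matrix (Fin N) (Fin k) ℂ) :
    (Fin k → ℂ[X]) →ₗ[ℂ] (Fin N → ℂ) where
  toFun p := ∑ a, aeval T (p a) *ᵥ E.col a
  map_add' p q := by simp [Matrix.add_mulVec, Finset.sum_add_distrib]
  map_smul' c p := by simp [Matrix.smul_mulVec, Finset.smul_sum]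

theorem vecEval_apply (T : Matrix (Fin N) (Fin N) ℂ) (E : Matrix (Fin N) (Fin k) ℂ)
    (p : Fin k → ℂ[X]) : vecEval T E p = ∑ a, aeval T (p a) *ᵥ E.col a := rfl

theorem vecEval_X_mul (T : Matrix (Fin N) (Fin N) ℂ) (E : Matrix (Fin N) (Fin k) ℂ)
    (p : Fin k → ℂ[X]) : vecEval T E (fun a => X * p a) = T *ᵥ vecEval T E p := by
  simp [vecEval_apply, Matrix.mulVec_sum, Matrix.mulVec_mulVec]

/-- The matrix `∑ᵢ Tⁱ E Fᵢ` for the matrix polynomial `F = ∑ᵢ Fᵢ Xⁱ`. -/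
def polyEval (T : Matrix (Fin N) (Fin N) ℂ) (E : Matrix (Fin N) (Fin k) ℂ)
    (F : Matrix (Fin k) (Fin r) ℂ[X]) : Matrix (Fin N) (Fin r) ℂ :=
  Matrix.of fun i j => vecEval T E (fun a => F a j) i

variable (T : Matrix (Fin N) (Fin N) ℂ) (E : Matrix (Fin N) (Fin k) ℂ)

theorem polyEval_apply (F : Matrix (Fin k) (Fin r) ℂ[X]) (i : Fin N) (j : Fin r) :
    polyEval T E F i j = vecEval T E (fun a => F a j) i := rfl

theorem polyEval_sub (F G : Matrix (Fin k) (Fin r) ℂ[X]) :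
    polyEval T E (F - G) = polyEval T E F - polyEval T E G := by
  ext i j
  have := congrFun ((vecEval T E).map_sub (fun a => F a j) (fun a => G a j)) i
  exact this

theorem polyEval_sum {ι : Type*} (S : Finset ι) (F : ι → Matrix (Fin k) (Fin r) ℂ[X]) :
    polyEval T E (∑ i ∈ S, F i) = ∑ i ∈ S, polyEval T E (F i) := by
  ext i j
  simp only [Matrix.sum_apply, polyEval_apply]
  rw [← Finset.sum_apply i S (fun x => vecEval T E fun a => F x a j), ← map_sum]
  have : (fun a => ∑ c ∈ S, F c a j) = ∑ x ∈ S, fun a => F x a j := by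
    funext a
    simp
  rw [this]

theorem polyEval_X_smul (F : Matrix (Fin k) (Fin r) ℂ[X]) :
    polyEval T E ((X : ℂ[X]) • F) = T * polyEval T E F := by
  ext i j
  exact congrFun (vecEval_X_mul T E fun a => F a j) i

theorem polyEval_mul_map_C (F : Matrix (Fin k) (Fin r) ℂ[X]) (M : Matrix (Fin r) (Fin s) ℂ) :
    polyEval T E (F * M.map C) = polyEval T E F * M := by
  ext i j
  have : (fun a => (F * M.map C) a j) = ∑ b, M b j • fun a => F a b := by
    funext a
    simp [Matrix.mul_apply, Polynomial.smul_eq_C_mul, mul_comm]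
  rw [polyEval_apply, this, map_sum, Matrix.mul_apply, Finset.sum_apply]
  refine Finset.sum_congr rfl fun b _ => ?_
  rw [map_smul, Pi.smul_apply, smul_eq_mul, mul_comm, polyEval_apply]

theorem polyEval_submatrix (F : Matrix (Fin k) (Fin r) ℂ[X]) (f : Fin s → Fin r) :
    polyEval T E (F.submatrix id f) = (polyEval T E F).submatrix id f := rfl

theorem polyEval_one : polyEval T E (1 : Matrix (Fin k) (Fin k) ℂ[X]) = E := by
  ext i j
  rw [polyEval_apply, vecEval_apply, Finset.sum_eq_single j]
  · simp
  · intro b _ hb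
    simp [Matrix.one_apply_ne hb]
  · simp

theorem polyEval_X_pow_smul_one (n : ℕ) :
    polyEval T E ((X ^ n : ℂ[X]) • (1 : Matrix (Fin k) (Fin k) ℂ[X])) = T ^ n * E := by
  induction n with
  | zero => simp [polyEval_one]
  | succ n ih =>
    rw [pow_succ', mul_smul, polyEval_X_smul, ih, pow_succ', Matrix.mul_assoc]

theorem polyEval_conj {U : Matrix (Fin N) (Fin N) ℂ} (hU : Uᴴ * U = 1)
    (F : Matrix (Fin k) (Fin r) ℂ[X]) :
    polyEval (U * T * Uᴴ) (U * E) F = U * polyEval T E F := by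
  have pw : ∀ n : ℕ, (U * T * Uᴴ) ^ n * U = U * T ^ n := by
    intro n
    induction n with
    | zero => simp
    | succ n ih =>
      rw [pow_succ, Matrix.mul_assoc, Matrix.mul_assoc _ Uᴴ, hU, Matrix.mul_one,
        ← Matrix.mul_assoc, ih, pow_succ, Matrix.mul_assoc]
  have ae : ∀ p : ℂ[X], aeval (U * T * Uᴴ) p * U = U * aeval T p := by
    intro p
    simp only [aeval_eq_sum_range, Finset.sum_mul, Finset.mul_sum, smul_mul_assoc,
      mul_smul_comm, pw]
  have col : ∀ a, (U * E).col a = U *ᵥ E.col a := by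
    intro a; ext i; simp [Matrix.mul_apply, Matrix.mulVec, dotProduct]
  ext i j
  rw [polyEval_apply, vecEval_apply]
  simp only [col, Matrix.mulVec_mulVec, ae]
  simp only [← Matrix.mulVec_mulVec, ← Matrix.mulVec_sum]
  rfl

/-- `(T, E)` realizes the quasi-inner product of `μ`. -/
def IsModel (μ : MatMeasure k) : Prop :=
  ∀ ⦃r s : ℕ⦄ (F : Matrix (Fin k) (Fin r) ℂ[X]) (G : Matrix (Fin k) (Fin s) ℂ[X]),
    quasiInner μ F G = (polyEval T E F)ᴴ * polyEval T E G

variable {T E}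

/-- All values are multiplied on the left by `U`, which leaves their Gram matrices unchanged. This
moves a diagonal model to `J`, and later to a banded matrix. -/
theorem IsModel.conj {μ : MatMeasure k} (h : IsModel T E μ) {U : Matrix (Fin N) (Fin N) ℂ}
    (hU : Uᴴ * U = 1) : IsModel (U * T * Uᴴ) (U * E) μ := by
  intro r s F G
  rw [polyEval_conj T E hU, polyEval_conj T E hU, Matrix.conjTranspose_mul, Matrix.mul_assoc,
    ← Matrix.mul_assoc Uᴴ, hU, Matrix.one_mul, h]

end Eval

/-! ### Finitely supported measures -/

section Atomic

variable {k : ℕ} {ι : Type*}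

theorem entryMeasure_apply (μ : MatMeasure k) (a b : Fin k) (t : Set ℝ) :
    entryMeasure μ a b t = μ t a b := rfl

open Classical in
theorem sum_dirac_apply {M : Type*} [AddCommMonoid M] [TopologicalSpace M] [ContinuousAdd M]
    (S : Finset ι) (x : ι → ℝ) (w : ι → M) {t : Set ℝ} (ht : MeasurableSet t) :
    (∑ l ∈ S, VectorMeasure.dirac (x l) (w l)) t = ∑ l ∈ S, if x l ∈ t then w l else 0 := by
  rw [FunLike.coe_sum, Finset.sum_apply]
  refine Finset.sum_congr rfl fun l _ => ?_
  by_cases hx : x l ∈ t <;> simp [hx, ht]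

theorem entryMeasure_sum_dirac (S : Finset ι) (x : ι → ℝ) (W : ι → Matrix (Fin k) (Fin k) ℂ)
    (a b : Fin k) :
    entryMeasure (∑ l ∈ S, VectorMeasure.dirac (x l) (W l)) a b =
      ∑ l ∈ S, VectorMeasure.dirac (x l) (W l a b) := by
  ext t ht
  rw [entryMeasure_apply, sum_dirac_apply _ _ _ ht, sum_dirac_apply _ _ _ ht, Matrix.sum_apply]
  refine Finset.sum_congr rfl fun l _ => ?_
  by_cases hx : x l ∈ t <;> simp [hx]

theorem quasiInner_sum_dirac (S : Finset ι) (x : ι → ℝ) (W : ι → Matrix (Fin k) (Fin k) ℂ)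
    {r s : ℕ} (F : Matrix (Fin k) (Fin r) ℂ[X]) (G : Matrix (Fin k) (Fin s) ℂ[X])
    (i : Fin r) (j : Fin s) :
    quasiInner (∑ l ∈ S, VectorMeasure.dirac (x l) (W l)) F G i j =
      ∑ l ∈ S, ∑ a, ∑ b,
        star ((F a i).eval (x l : ℂ)) * (G b j).eval (x l : ℂ) * W l a b := by
  have : ∀ a b : Fin k, ∀ f : ℝ → ℂ,
      (entryMeasure (∑ l ∈ S, VectorMeasure.dirac (x l) (W l)) a b).integral f
        (ContinuousLinearMap.mul ℝ ℂ) = ∑ l ∈ S, f (x l) * W l a b := by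
    intro a b f
    rw [entryMeasure_sum_dirac, VectorMeasure.integral_finsetSum_vectorMeasure]
    · simp
    · intro l _
      rw [VectorMeasure.Integrable, VectorMeasure.variation_dirac]
      exact (integrable_dirac (by simp)).smul_measure (by simp)
  simp only [quasiInner, Matrix.of_apply, this]
  rw [Finset.sum_comm (s := S)]
  exact Finset.sum_congr rfl fun a _ => Finset.sum_comm

/-- Finitely supported measures with the same quasi-inner product are equal. -/
theorem sum_dirac_ext {κ : Type*} (S : Finset ι) (x : ι → ℝ) (W : ι → Matrix (Fin k) (Fin k) ℂ)
    (S' : Finset κ) (x' : κ → ℝ) (W' : κ → Matrix (Fin k) (Fin k) ℂ)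
    (h : ∀ {r s : ℕ} (F : Matrix (Fin k) (Fin r) ℂ[X]) (G : Matrix (Fin k) (Fin s) ℂ[X]),
      quasiInner (∑ l ∈ S, VectorMeasure.dirac (x l) (W l)) F G =
        quasiInner (∑ l ∈ S', VectorMeasure.dirac (x' l) (W' l)) F G) :
    ∑ l ∈ S, VectorMeasure.dirac (x l) (W l) = ∑ l ∈ S', VectorMeasure.dirac (x' l) (W' l) := by
  classical
  ext1 t ht
  rw [sum_dirac_apply _ _ _ ht, sum_dirac_apply _ _ _ ht]
  -- On the finitely many atoms of both measures, Lagrange interpolation replaces the indicator of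
  -- `t` by a polynomial `f`. The mass of `t` is then the quasi-inner product of `1` and `f • 1`.
  obtain ⟨f, hf⟩ : ∃ f : ℂ[X], ∀ y ∈ S.image x ∪ S'.image x',
      f.eval (y : ℂ) = if y ∈ t then 1 else 0 :=
    ⟨Lagrange.interpolate (S.image x ∪ S'.image x') (fun y => (y : ℂ))
      (fun y => if y ∈ t then 1 else 0), fun y hy =>
      Lagrange.eval_interpolate_at_node _ Complex.ofReal_injective.injOn hy⟩
  ext a b
  have key := congrFun (congrFun (h (1 : Matrix (Fin k) (Fin k) ℂ[X])
    (f • (1 : Matrix (Fin k) (Fin k) ℂ[X]))) a) b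
  rw [quasiInner_sum_dirac, quasiInner_sum_dirac] at key
  have simp_term : ∀ (y : ℝ) (V : Matrix (Fin k) (Fin k) ℂ),
      y ∈ S.image x ∪ S'.image x' →
      ∑ c, ∑ d, star (((1 : Matrix (Fin k) (Fin k) ℂ[X]) c a).eval (y : ℂ)) *
        ((f • (1 : Matrix (Fin k) (Fin k) ℂ[X])) d b).eval (y : ℂ) * V c d =
      (if y ∈ t then V else 0) a b := by
    intro y V hy
    rw [Finset.sum_eq_single a, Finset.sum_eq_single b]
    · by_cases hyt : y ∈ t <;> simp [hf y hy, hyt]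
    · intro d _ hd
      simp [Matrix.one_apply_ne hd]
    · simp
    · intro c _ hc
      simp [Matrix.one_apply_ne hc]
    · simp
  rw [Finset.sum_congr rfl fun l hl => simp_term (x l) (W l)
      (Finset.mem_union_left _ (Finset.mem_image_of_mem x hl)),
    Finset.sum_congr rfl fun l hl => simp_term (x' l) (W' l)
      (Finset.mem_union_right _ (Finset.mem_image_of_mem x' hl))] at key
  rw [Matrix.sum_apply, Matrix.sum_apply, key]

/-- The measure `∑ₗ vₗ vₗᴴ δ_{λₗ}`. -/
def rankOneSum {N : ℕ} (lam : Fin N → ℝ) (v : Fin N → Fin k → ℂ) : MatMeasure k :=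
  ∑ l, VectorMeasure.dirac (lam l) (Matrix.vecMulVec (v l) (star (v l)))

theorem aeval_diagonal {N : ℕ} (d : Fin N → ℂ) (p : ℂ[X]) :
    aeval (Matrix.diagonal d) p = Matrix.diagonal fun l => p.eval (d l) := by
  have := Polynomial.aeval_algHom_apply (Matrix.diagonalAlgHom ℂ) d p
  rw [show Matrix.diagonal d = Matrix.diagonalAlgHom ℂ d from rfl, this]
  change Matrix.diagonal _ = _
  congr 1
  funext l
  simp

/-- Row `l` of the value of `F` is `v_lᴴ F(λ_l)`, so the Gram matrix of two values is `∑ F(λ_l)ᴴ v_l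
v_lᴴ G(λ_l)`. -/
theorem isModel_rankOneSum {N : ℕ} (lam : Fin N → ℝ) (v : Fin N → Fin k → ℂ) :
    IsModel (Matrix.diagonal fun l => (lam l : ℂ)) (Matrix.of fun l a => star (v l a))
      (rankOneSum lam v) := by
  intro r s F G
  ext i j
  have ev : ∀ {t : ℕ} (H : Matrix (Fin k) (Fin t) ℂ[X]) (l : Fin N) (j : Fin t),
      polyEval (Matrix.diagonal fun l => (lam l : ℂ)) (Matrix.of fun l a => star (v l a)) H l j =
        ∑ a, (H a j).eval (lam l : ℂ) * star (v l a) := by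
    intro t H l j
    rw [polyEval_apply, vecEval_apply, Finset.sum_apply]
    refine Finset.sum_congr rfl fun a _ => ?_
    rw [aeval_diagonal, Matrix.mulVec_diagonal]
    rfl
  rw [rankOneSum, quasiInner_sum_dirac, Matrix.mul_apply]
  refine Finset.sum_congr rfl fun l _ => ?_
  rw [Matrix.conjTranspose_apply, ev, ev, star_sum, Finset.sum_mul_sum]
  refine Finset.sum_congr rfl fun a _ => Finset.sum_congr rfl fun b _ => ?_
  simp only [Matrix.vecMulVec_apply, Pi.star_apply, star_mul', star_star]
  ring

theorem rankOneSum_eq_of_isModel {N : ℕ} {lam lam' : Fin N → ℝ} {v v' : Fin N → Fin k → ℂ}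
    {T : Matrix (Fin N) (Fin N) ℂ} {E : Matrix (Fin N) (Fin k) ℂ}
    (h : IsModel T E (rankOneSum lam v)) (h' : IsModel T E (rankOneSum lam' v')) :
    rankOneSum lam v = rankOneSum lam' v' :=
  sum_dirac_ext _ _ _ _ _ _ fun F G => (h F G).trans (h' F G).symm

theorem dirac_sum (x : ℝ) (S : Finset ι) (w : ι → Matrix (Fin k) (Fin k) ℂ) :
    VectorMeasure.dirac x (∑ l ∈ S, w l) = ∑ l ∈ S, VectorMeasure.dirac x (w l) := by
  ext1 t ht
  rw [sum_dirac_apply S (fun _ => x) w ht]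
  by_cases hx : x ∈ t <;> simp [hx, ht]

/-- The vectors are the eigenvectors scaled by the square roots of their eigenvalues; the rank
counts the nonzero eigenvalues, and the other terms drop out. -/
theorem exists_eq_sum_vecMulVec_of_posSemidef {M : Matrix (Fin k) (Fin k) ℂ} (hM : M.PosSemidef) :
    ∃ v : Fin M.rank → Fin k → ℂ, M = ∑ i, Matrix.vecMulVec (v i) (star (v i)) := by
  have hc := hM.1.rank_eq_card_non_zero_eigs
  let e : Fin M.rank ≃ {i // hM.1.eigenvalues i ≠ 0} :=
    (finCongr hc).trans (Fintype.equivFin _).symm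
  let w : Fin k → Fin k → ℂ := fun i a =>
    (Real.sqrt (hM.1.eigenvalues i) : ℂ) * hM.1.eigenvectorBasis i a
  refine ⟨fun l => w (e l), ?_⟩
  have h1 : ∑ l, Matrix.vecMulVec (w (e l)) (star (w (e l))) =
      ∑ i, Matrix.vecMulVec (w i) (star (w i)) := by
    rw [e.sum_comp (fun i => Matrix.vecMulVec (w i) (star (w i)))]
    rw [← Finset.sum_subtype (Finset.univ.filter fun i => hM.1.eigenvalues i ≠ 0) (by simp)
      (fun i => Matrix.vecMulVec (w i) (star (w i)))]
    refine Finset.sum_subset (Finset.subset_univ _) fun i _ hi => ?_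
    have h0 : hM.1.eigenvalues i = 0 := by simpa using hi
    ext a b
    simp [w, h0, Matrix.vecMulVec_apply]
  rw [h1]
  ext a b
  conv_lhs => rw [hM.1.spectral_theorem, Unitary.conjStarAlgAut_apply]
  rw [Matrix.mul_apply, Matrix.sum_apply]
  refine Finset.sum_congr rfl fun i _ => ?_
  have hs : ((Real.sqrt (hM.1.eigenvalues i) : ℂ)) * (Real.sqrt (hM.1.eigenvalues i) : ℂ) =
      (hM.1.eigenvalues i : ℂ) := by
    rw [← Complex.ofReal_mul, Real.mul_self_sqrt (hM.eigenvalues_nonneg i)]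
  simp only [Matrix.mul_diagonal, Matrix.star_apply, Matrix.vecMulVec_apply, w, Pi.star_apply,
    Function.comp_apply, IsHermitian.eigenvectorUnitary_apply, star_mul', Complex.star_def,
    Complex.conj_ofReal, Complex.coe_algebraMap]
  change _ * (hM.1.eigenvalues i : ℂ) * _ = _
  rw [← hs]
  ring

/-- Every finitely supported positive semidefinite measure of total rank `N` is a sum of `N` rank
one atoms. -/
theorem exists_eq_rankOneSum {N : ℕ} (s : Finset ℝ) (W : ℝ → Matrix (Fin k) (Fin k) ℂ)
    (hW : ∀ x ∈ s, (W x).PosSemidef) (hN : ∑ x ∈ s, (W x).rank = N) :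
    ∃ (lam : Fin N → ℝ) (v : Fin N → Fin k → ℂ),
      ∑ x ∈ s, VectorMeasure.dirac x (W x) = rankOneSum lam v := by
  choose! v hv using fun x (hx : x ∈ s) => exists_eq_sum_vecMulVec_of_posSemidef (hW x hx)
  let I := Σ x : s, Fin (W x).rank
  have hcard : Fintype.card I = N := by
    rw [Fintype.card_sigma, ← hN, ← Finset.sum_coe_sort s fun x => (W x).rank]
    simp
  let e : Fin N ≃ I := (finCongr hcard.symm).trans (Fintype.equivFin I).symm
  refine ⟨fun l => (e l).1, fun l => v (e l).1 (e l).2, ?_⟩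
  rw [rankOneSum, e.sum_comp (fun i : I =>
    VectorMeasure.dirac (i.1 : ℝ) (Matrix.vecMulVec (v i.1 i.2) (star (v i.1 i.2)))),
    Fintype.sum_sigma, ← Finset.sum_coe_sort s]
  refine Finset.sum_congr rfl fun x _ => ?_
  exact (congrArg _ (hv x x.2)).trans (dirac_sum _ _ _)

end Atomic

/-! ### Krylov matrices and the dimensions of the null spaces -/

section Krylov

variable {k N : ℕ}

/-- The matrix `(E, T E, …, T^{d-1} E)`. -/
def krylov (T : Matrix (Fin N) (Fin N) ℂ) (E : Matrix (Fin N) (Fin k) ℂ) (d : ℕ) :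
    Matrix (Fin N) (Fin (d * k)) ℂ :=
  Matrix.of fun i c => (T ^ (c.divNat : ℕ) * E) i c.modNat

/-- The vector polynomial with a given vector of coefficients. -/
def vecPoly (k d : ℕ) : (Fin (d * k) → ℂ) →ₗ[ℂ] (Fin k → ℂ[X]) where
  toFun x a := ∑ i : Fin d, x (finProdFinEquiv (i, a)) • (X : ℂ[X]) ^ (i : ℕ)
  map_add' x y := by
    funext a; simp [add_smul, Finset.sum_add_distrib]
  map_smul' c x := by
    funext a; simp [mul_smul, Finset.smul_sum]

theorem vecPoly_apply (d : ℕ) (x : Fin (d * k) → ℂ) (a : Fin k) :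
    vecPoly k d x a = ∑ i : Fin d, x (finProdFinEquiv (i, a)) • (X : ℂ[X]) ^ (i : ℕ) := rfl

theorem coeff_vecPoly (d : ℕ) (x : Fin (d * k) → ℂ) (a : Fin k) (i : Fin d) :
    (vecPoly k d x a).coeff i = x (finProdFinEquiv (i, a)) := by
  rw [vecPoly_apply, Polynomial.finsetSum_coeff, Finset.sum_eq_single i]
  · simp
  · intro b _ hb
    simp [Polynomial.coeff_X_pow, Fin.val_ne_of_ne hb.symm]
  · simp

theorem coeff_vecPoly_of_le (d : ℕ) (x : Fin (d * k) → ℂ) (a : Fin k) {i : ℕ} (hi : d ≤ i) :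
    (vecPoly k d x a).coeff i = 0 := by
  rw [vecPoly_apply, Polynomial.finsetSum_coeff]
  refine Finset.sum_eq_zero fun b _ => ?_
  have : i ≠ b := by omega
  simp [Polynomial.coeff_X_pow, this]

theorem vecPoly_injective (k d : ℕ) : Function.Injective (vecPoly k d) := by
  intro x y h
  funext c
  obtain ⟨⟨i, a⟩, rfl⟩ := finProdFinEquiv.surjective c
  rw [← coeff_vecPoly d x, h, coeff_vecPoly]

theorem exists_vecPoly_eq (d : ℕ) (p : Fin k → ℂ[X])
    (hp : ∀ a i, d ≤ i → (p a).coeff i = 0) : ∃ x, vecPoly k d x = p := by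
  refine ⟨fun c => (p c.modNat).coeff c.divNat, ?_⟩
  funext a
  ext i
  by_cases hi : i < d
  · have := coeff_vecPoly d (fun c => (p c.modNat).coeff c.divNat) a ⟨i, hi⟩
    rw [this]
    have h1 := finProdFinEquiv.symm_apply_apply ((⟨i, hi⟩ : Fin d), a)
    rw [finProdFinEquiv_symm_apply, Prod.mk.injEq] at h1
    simp only [h1]
  · rw [coeff_vecPoly_of_le _ _ _ (not_lt.1 hi), hp a i (not_lt.1 hi)]

theorem vecEval_vecPoly (T : Matrix (Fin N) (Fin N) ℂ) (E : Matrix (Fin N) (Fin k) ℂ) (d : ℕ)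
    (x : Fin (d * k) → ℂ) : vecEval T E (vecPoly k d x) = krylov T E d *ᵥ x := by
  funext l
  rw [vecEval_apply, Matrix.mulVec, dotProduct, ← finProdFinEquiv.sum_comp,
    Fintype.sum_prod_type_right, Finset.sum_apply]
  refine Finset.sum_congr rfl fun a _ => ?_
  simp only [vecPoly_apply, map_sum, map_smul, aeval_X_pow]
  rw [Matrix.sum_mulVec, Finset.sum_apply]
  refine Finset.sum_congr rfl fun i _ => ?_
  have h1 := finProdFinEquiv.symm_apply_apply (i, a)
  rw [finProdFinEquiv_symm_apply, Prod.mk.injEq] at h1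
  simp only [krylov, Matrix.of_apply, h1]
  rw [Matrix.smul_mulVec, Pi.smul_apply, smul_eq_mul, mul_comm]
  rfl

variable {T : Matrix (Fin N) (Fin N) ℂ} {E : Matrix (Fin N) (Fin k) ℂ} {μ : MatMeasure k}

theorem IsModel.mem_nullPolys (h : IsModel T E μ) {d : ℕ} {p : Fin k → ℂ[X]} :
    p ∈ nullPolys μ d ↔ (∀ a, (p a).natDegree ≤ d) ∧ vecEval T E p = 0 := by
  rw [nullPolys, Set.mem_ofPred_eq, h, Matrix.conjTranspose_mul_self_eq_zero]
  refine and_congr_right fun _ => ⟨fun h0 => ?_, fun h0 => ?_⟩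
  · funext i
    exact congrFun (congrFun h0 i) 0
  · ext i j
    exact congrFun h0 i

/-- Since `⟨p, p⟩_μ` is the squared norm of the value of `p`, the coefficient vectors of `𝒩_d` form
the kernel of the Krylov matrix with `d + 1` blocks, and rank-nullity applies. -/
theorem IsModel.finrank_nullPolys (h : IsModel T E μ) (d : ℕ) :
    Set.finrank ℂ (nullPolys μ d) + (krylov T E (d + 1)).rank = (d + 1) * k := by
  have e : nullPolys μ d =
      ((LinearMap.ker (krylov T E (d + 1)).mulVecLin).map (vecPoly k (d + 1)) :
        Set (Fin k → ℂ[X])) := by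
    ext p
    rw [h.mem_nullPolys]
    constructor
    · rintro ⟨hd, hp⟩
      obtain ⟨x, rfl⟩ := exists_vecPoly_eq (d + 1) p fun a i hi =>
        Polynomial.coeff_eq_zero_of_natDegree_lt (lt_of_le_of_lt (hd a) hi)
      refine ⟨x, ?_, rfl⟩
      rw [vecEval_vecPoly] at hp
      exact hp
    · rintro ⟨x, hx, rfl⟩
      refine ⟨fun a => ?_, ?_⟩
      · rw [Polynomial.natDegree_le_iff_coeff_eq_zero]
        exact fun i hi => coeff_vecPoly_of_le _ _ _ hi
      · rw [vecEval_vecPoly]; exact hx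
  rw [Set.finrank, e, Submodule.span_eq,
    LinearEquiv.finrank_eq (Submodule.equivMapOfInjective _ (vecPoly_injective k (d + 1)) _).symm,
    add_comm, Matrix.rank, LinearMap.finrank_range_add_finrank_ker]
  simp

end Krylov

/-! ### The spectral measure -/

section SpectralMap

variable {k N : ℕ}

theorem mul_one_submatrix {m : Type*} {r : ℕ} (M : Matrix m (Fin N) ℂ) (f : Fin r → Fin N) :
    M * (1 : Matrix (Fin N) (Fin N) ℂ).submatrix id f = M.submatrix id f := by
  ext i j
  simp [Matrix.mul_apply, Matrix.one_apply]

/-- The first `k` columns of the identity matrix. -/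
def headCols (hkN : k ≤ N) : Matrix (Fin N) (Fin k) ℂ :=
  (1 : Matrix (Fin N) (Fin N) ℂ).submatrix id (Fin.castLE hkN)

theorem spectralMap_eq (hkN : k ≤ N) {J : Matrix (Fin N) (Fin N) ℂ} (hJ : J.IsHermitian) :
    spectralMap hkN J = rankOneSum hJ.eigenvalues (eigenvectorHead hkN hJ) :=
  dif_pos hJ

/-- With `J = U Λ Uᴴ`, the rows of `Uᴴ E` are the vectors `v_lᴴ`, so this is the diagonal model of
`φ(J)` conjugated by `U`. -/
theorem isModel_spectralMap (hkN : k ≤ N) {J : Matrix (Fin N) (Fin N) ℂ} (hJ : J.IsHermitian) :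
    IsModel J (headCols hkN) (spectralMap hkN J) := by
  rw [spectralMap_eq hkN hJ]
  have hU : (hJ.eigenvectorUnitary : Matrix (Fin N) (Fin N) ℂ)ᴴ * hJ.eigenvectorUnitary = 1 :=
    Unitary.coe_star_mul_self hJ.eigenvectorUnitary
  have hU' : (hJ.eigenvectorUnitary : Matrix (Fin N) (Fin N) ℂ) *
      (hJ.eigenvectorUnitary : Matrix (Fin N) (Fin N) ℂ)ᴴ = 1 :=
    Unitary.coe_mul_star_self hJ.eigenvectorUnitary
  have h := (isModel_rankOneSum hJ.eigenvalues (eigenvectorHead hkN hJ)).conj hU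
  have e1 : (hJ.eigenvectorUnitary : Matrix (Fin N) (Fin N) ℂ) *
      (Matrix.diagonal fun l => (hJ.eigenvalues l : ℂ)) *
      (hJ.eigenvectorUnitary : Matrix (Fin N) (Fin N) ℂ)ᴴ = J := by
    conv_rhs => rw [hJ.spectral_theorem, Unitary.conjStarAlgAut_apply]
    rfl
  have e2 : (Matrix.of fun l a => star (eigenvectorHead hkN hJ l a)) =
      (hJ.eigenvectorUnitary : Matrix (Fin N) (Fin N) ℂ)ᴴ * headCols hkN := by
    rw [headCols, mul_one_submatrix]
    rfl
  rw [e1, e2, ← Matrix.mul_assoc, hU', Matrix.one_mul] at h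
  exact h

end SpectralMap

/-! ### Block structure -/

section Blocks

variable {k N : ℕ}

theorem lt_numBlocks_iff (hk : 0 < k) {j : ℕ} : j < numBlocks k N ↔ j * k < N := by
  rw [← not_le, ← not_le, numBlocks, ceilDiv_le_iff_le_mul hk, mul_comm]

theorem blockSize_eq (hk : 0 < k) {j : ℕ} (h : j + 1 < numBlocks k N) : blockSize k N j = k := by
  rw [lt_numBlocks_iff hk, add_mul] at h
  rw [blockSize]
  omega

theorem isEmpty_block (hk : 0 < k) {j : ℕ} (h : ¬ j < numBlocks k N) :
    IsEmpty (Fin (blockSize k N j)) := by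
  rw [lt_numBlocks_iff hk] at h
  rw [blockSize]
  have : min k (N - j * k) = 0 := by omega
  rw [this]
  infer_instance

theorem blockIndex_div {j : ℕ} (a : Fin (blockSize k N j)) : (blockIndex k N j a : ℕ) / k = j := by
  have h : (a : ℕ) < k := lt_of_lt_of_le a.isLt (blockSize_le k N j)
  change (j * k + a) / k = j
  rw [mul_comm, Nat.mul_add_div (by omega), Nat.div_eq_of_lt h, add_zero]

theorem blockIndex_injective (j : ℕ) : Function.Injective (blockIndex k N j) := by
  intro a b h
  have := congrArg Fin.val h
  simp only [blockIndex] at this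
  exact Fin.ext (by omega)

theorem exists_blockIndex_eq (hk : 0 < k) (r : Fin N) :
    ∃ a : Fin (blockSize k N (r / k)), blockIndex k N (r / k) a = r := by
  have h1 := Nat.div_add_mod (r : ℕ) k
  have h2 := Nat.mod_lt (r : ℕ) hk
  refine ⟨⟨r % k, ?_⟩, Fin.ext ?_⟩
  · rw [blockSize, lt_min_iff]
    refine ⟨h2, ?_⟩
    have := r.isLt
    rw [mul_comm] at h1
    omega
  · change r / k * k + r % k = r
    rw [mul_comm]; exact h1

theorem mul_blockSel {m : Type*} (M : Matrix m (Fin N) ℂ) (j : ℕ) :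
    M * blockSel k N j = M.submatrix id (blockIndex k N j) :=
  mul_one_submatrix M _

theorem conjTranspose_blockSel_mul {m : Type*} (M : Matrix (Fin N) m ℂ) (j : ℕ) :
    (blockSel k N j)ᴴ * M = M.submatrix (blockIndex k N j) id := by
  rw [← Matrix.conjTranspose_conjTranspose M, ← Matrix.conjTranspose_mul, mul_blockSel]
  rfl

theorem conjTranspose_blockSel_mul_self (j : ℕ) : (blockSel k N j)ᴴ * blockSel k N j = 1 := by
  rw [conjTranspose_blockSel_mul, blockSel, Matrix.submatrix_submatrix]
  exact Matrix.submatrix_one _ (blockIndex_injective j)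

theorem blockSel_apply_eq_zero {j : ℕ} {r : Fin N} (h : (r : ℕ) / k ≠ j)
    (a : Fin (blockSize k N j)) : blockSel k N j r a = 0 := by
  refine Matrix.one_apply_ne fun hr => h ?_
  rw [id] at hr
  rw [hr, blockIndex_div]

theorem blockSel_mul_apply_eq_zero {m : Type*} {j : ℕ} {r : Fin N} (h : (r : ℕ) / k ≠ j)
    (M : Matrix (Fin (blockSize k N j)) m ℂ) (c : m) : (blockSel k N j * M) r c = 0 := by
  rw [Matrix.mul_apply]
  exact Finset.sum_eq_zero fun a _ => by rw [blockSel_apply_eq_zero h, zero_mul]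

theorem conjTranspose_blockSel_mul_of_ne {i j : ℕ} (h : i ≠ j) :
    (blockSel k N i)ᴴ * blockSel k N j = 0 := by
  rw [conjTranspose_blockSel_mul]
  ext a b
  exact blockSel_apply_eq_zero (by rwa [blockIndex_div]) b

theorem blockSel_eq_of_forall {m : Type*} (hk : 0 < k) {M M' : Matrix (Fin N) m ℂ}
    (h : ∀ j, j < numBlocks k N → (blockSel k N j)ᴴ * M = (blockSel k N j)ᴴ * M') : M = M' := by
  ext r c
  obtain ⟨a, ha⟩ := exists_blockIndex_eq hk r
  have hj : (r : ℕ) / k < numBlocks k N := by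
    rw [lt_numBlocks_iff hk]
    exact lt_of_le_of_lt (Nat.div_mul_le_self _ _) r.isLt
  have := congrFun (congrFun (h _ hj) a) c
  rw [conjTranspose_blockSel_mul, conjTranspose_blockSel_mul] at this
  simpa [ha] using this

variable (A : ∀ j, Matrix (Fin (blockSize k N j)) (Fin (blockSize k N j)) ℂ)
  (B : ∀ j, Matrix (Fin (blockSize k N (j + 1))) (Fin (blockSize k N j)) ℂ)

/-- The extra off-diagonal term `j = n - 1` involves the empty block `n` and vanishes. Letting both
sums run over the same range removes the boundary cases from the column formulas below. -/
theorem blockTridiag_eq_sum (hk : 0 < k) (hkN : k ≤ N) :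
    blockTridiag k N A B = ∑ j ∈ Finset.range (numBlocks k N),
      (blockSel k N j * A j * (blockSel k N j)ᴴ + blockSel k N (j + 1) * B j * (blockSel k N j)ᴴ +
        blockSel k N j * (B j)ᴴ * (blockSel k N (j + 1))ᴴ) := by
  have hn : 0 < numBlocks k N := (lt_numBlocks_iff hk).2 (by omega)
  rw [blockTridiag]
  simp only [add_assoc]
  rw [Finset.sum_add_distrib (s := Finset.range (numBlocks k N))]
  congr 1
  refine Finset.sum_subset (Finset.range_mono (Nat.sub_le _ _)) fun j _ hj => ?_
  have : IsEmpty (Fin (blockSize k N (j + 1))) := isEmpty_block hk (by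
    rw [Finset.mem_range] at hj; omega)
  ext r c
  simp [Matrix.mul_apply]

theorem blockTridiag_mul_blockSel_zero (hk : 0 < k) (hkN : k ≤ N) :
    blockTridiag k N A B * blockSel k N 0 = blockSel k N 0 * A 0 + blockSel k N 1 * B 0 := by
  have hn : 0 < numBlocks k N := (lt_numBlocks_iff hk).2 (by omega)
  rw [blockTridiag_eq_sum A B hk hkN, Matrix.sum_mul, Finset.sum_eq_single 0]
  · simp only [Matrix.add_mul, Matrix.mul_assoc, conjTranspose_blockSel_mul_self,
      conjTranspose_blockSel_mul_of_ne (k := k) (N := N) (show 0 + 1 ≠ 0 by omega),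
      Matrix.mul_one, Matrix.mul_zero, add_zero]
  · intro j _ hj
    simp only [Matrix.add_mul, Matrix.mul_assoc,
      conjTranspose_blockSel_mul_of_ne (k := k) (N := N) hj,
      conjTranspose_blockSel_mul_of_ne (k := k) (N := N) (show j + 1 ≠ 0 by omega),
      Matrix.mul_zero, add_zero]
  · intro h
    exact absurd (Finset.mem_range.2 hn) h

/-- This is the three-term recurrence in matrix form. It needs no bound on `j`, because the blocks
from `n` on are empty. -/
theorem blockTridiag_mul_blockSel_succ (hk : 0 < k) (hkN : k ≤ N) (j : ℕ) :
    blockTridiag k N A B * blockSel k N (j + 1) =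
      blockSel k N (j + 1) * A (j + 1) + blockSel k N (j + 2) * B (j + 1) +
        blockSel k N j * (B j)ᴴ := by
  by_cases hj : j + 1 < numBlocks k N
  · rw [blockTridiag_eq_sum A B hk hkN, Matrix.sum_mul,
      Finset.sum_eq_add_of_mem (j + 1) j (Finset.mem_range.2 hj)
        (Finset.mem_range.2 (by omega)) (by omega)]
    · simp only [Matrix.add_mul, Matrix.mul_assoc, conjTranspose_blockSel_mul_self,
        conjTranspose_blockSel_mul_of_ne (k := k) (N := N) (show j + 1 + 1 ≠ j + 1 by omega),
        conjTranspose_blockSel_mul_of_ne (k := k) (N := N) (show j ≠ j + 1 by omega),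
        Matrix.mul_one, Matrix.mul_zero, add_zero, zero_add]
    · rintro i _ ⟨h1, h2⟩
      simp only [Matrix.add_mul, Matrix.mul_assoc,
        conjTranspose_blockSel_mul_of_ne (k := k) (N := N) h1,
        conjTranspose_blockSel_mul_of_ne (k := k) (N := N) (show i + 1 ≠ j + 1 by omega),
        Matrix.mul_zero, add_zero]
  · have := isEmpty_block hk hj
    ext r a
    exact this.elim a

theorem blockTridiag_apply_eq_zero (hk : 0 < k) (hkN : k ≤ N) {r c : Fin N}
    (h : (c : ℕ) / k + 1 < (r : ℕ) / k) : blockTridiag k N A B r c = 0 := by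
  obtain ⟨a, ha⟩ := exists_blockIndex_eq hk c
  generalize hj : (c : ℕ) / k = j at a ha h
  have e : blockTridiag k N A B r c = (blockTridiag k N A B * blockSel k N j) r a := by
    rw [mul_blockSel, Matrix.submatrix_apply, ha, id]
  rw [e]
  cases j with
  | zero =>
    rw [blockTridiag_mul_blockSel_zero A B hk hkN, Matrix.add_apply,
      blockSel_mul_apply_eq_zero (by omega), blockSel_mul_apply_eq_zero (by omega), add_zero]
  | succ j =>
    rw [blockTridiag_mul_blockSel_succ A B hk hkN, Matrix.add_apply, Matrix.add_apply,
      blockSel_mul_apply_eq_zero (by omega), blockSel_mul_apply_eq_zero (by omega),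
      blockSel_mul_apply_eq_zero (by omega), add_zero, add_zero]

variable {A B}

theorem blockTridiag_isHermitian (hA : ∀ j, j < numBlocks k N → (A j).IsHermitian) :
    (blockTridiag k N A B).IsHermitian := by
  rw [Matrix.IsHermitian, blockTridiag, Matrix.conjTranspose_add, Matrix.conjTranspose_sum,
    Matrix.conjTranspose_sum]
  congr 1
  · refine Finset.sum_congr rfl fun j hj => ?_
    simp only [Matrix.conjTranspose_mul, Matrix.conjTranspose_conjTranspose,
      (hA j (Finset.mem_range.1 hj)).eq, Matrix.mul_assoc]
  · refine Finset.sum_congr rfl fun j hj => ?_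
    simp only [Matrix.conjTranspose_add, Matrix.conjTranspose_mul,
      Matrix.conjTranspose_conjTranspose, Matrix.mul_assoc]
    exact add_comm _ _

theorem conjTranspose_blockSel_mul_blockTridiag_mul_blockSel (hk : 0 < k) (hkN : k ≤ N) (j : ℕ) :
    (blockSel k N j)ᴴ * (blockTridiag k N A B * blockSel k N j) = A j := by
  cases j with
  | zero =>
    rw [blockTridiag_mul_blockSel_zero A B hk hkN, Matrix.mul_add, ← Matrix.mul_assoc,
      ← Matrix.mul_assoc, conjTranspose_blockSel_mul_self,
      conjTranspose_blockSel_mul_of_ne (show 0 ≠ 1 by omega), Matrix.one_mul, Matrix.zero_mul,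
      add_zero]
  | succ j =>
    rw [blockTridiag_mul_blockSel_succ A B hk hkN, Matrix.mul_add, Matrix.mul_add,
      ← Matrix.mul_assoc, ← Matrix.mul_assoc, ← Matrix.mul_assoc, conjTranspose_blockSel_mul_self,
      conjTranspose_blockSel_mul_of_ne (show j + 1 ≠ j + 2 by omega),
      conjTranspose_blockSel_mul_of_ne (show j + 1 ≠ j by omega), Matrix.one_mul, Matrix.zero_mul,
      Matrix.zero_mul, add_zero, add_zero]

theorem conjTranspose_blockSel_succ_mul_blockTridiag_mul_blockSel (hk : 0 < k) (hkN : k ≤ N)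
    (j : ℕ) : (blockSel k N (j + 1))ᴴ * (blockTridiag k N A B * blockSel k N j) = B j := by
  cases j with
  | zero =>
    rw [blockTridiag_mul_blockSel_zero A B hk hkN, Matrix.mul_add, ← Matrix.mul_assoc,
      ← Matrix.mul_assoc, conjTranspose_blockSel_mul_self,
      conjTranspose_blockSel_mul_of_ne (show 0 + 1 ≠ 0 by omega), Matrix.one_mul, Matrix.zero_mul]
    exact zero_add _
  | succ j =>
    rw [blockTridiag_mul_blockSel_succ A B hk hkN, Matrix.mul_add, Matrix.mul_add,
      ← Matrix.mul_assoc, ← Matrix.mul_assoc, ← Matrix.mul_assoc, conjTranspose_blockSel_mul_self,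
      conjTranspose_blockSel_mul_of_ne (show j + 1 + 1 ≠ j + 1 by omega),
      conjTranspose_blockSel_mul_of_ne (show j + 1 + 1 ≠ j by omega), Matrix.one_mul,
      Matrix.zero_mul, Matrix.zero_mul, add_zero, zero_add]

end Blocks

/-! ### The polynomials of a block tridiagonal matrix -/

section Recurrence

variable {k N : ℕ}

/-- The polynomials generated by the three-term recurrence with coefficients `A`, `B`. -/
def recPoly (A : ∀ j, Matrix (Fin (blockSize k N j)) (Fin (blockSize k N j)) ℂ)
    (B : ∀ j, Matrix (Fin (blockSize k N (j + 1))) (Fin (blockSize k N j)) ℂ) :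
    ∀ j, Matrix (Fin k) (Fin (blockSize k N j)) ℂ[X]
  | 0 => (1 : Matrix (Fin k) (Fin k) ℂ[X]).submatrix id (Fin.castLE (blockSize_le k N 0))
  | 1 => ((X : ℂ[X]) • recPoly A B 0 - recPoly A B 0 * (A 0).map C) * (rightInv (B 0)).map C
  | j + 2 => ((X : ℂ[X]) • recPoly A B (j + 1) - recPoly A B (j + 1) * (A (j + 1)).map C -
      recPoly A B j * (B j)ᴴ.map C) * (rightInv (B (j + 1))).map C

variable {A : ∀ j, Matrix (Fin (blockSize k N j)) (Fin (blockSize k N j)) ℂ}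
  {B : ∀ j, Matrix (Fin (blockSize k N (j + 1))) (Fin (blockSize k N j)) ℂ}

/-- `residual` takes the whole family of polynomials, whereas the recursion for `recPoly` refers
only to earlier members; here the two forms are identified. -/
theorem recPoly_succ (j : ℕ) :
    recPoly A B (j + 1) = residual (recPoly A B) A B j * (rightInv (B j)).map C := by
  cases j <;> simp only [recPoly, residual]

theorem natDegree_mul_map_C_le {r s d : ℕ} {F : Matrix (Fin k) (Fin r) ℂ[X]}
    (hF : ∀ a b, (F a b).natDegree ≤ d) (M : Matrix (Fin r) (Fin s) ℂ) (a : Fin k) (b : Fin s) :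
    ((F * M.map C) a b).natDegree ≤ d := by
  rw [Matrix.mul_apply]
  refine Polynomial.natDegree_sum_le_of_forall_le _ _ fun c _ => ?_
  rw [Matrix.map_apply]
  exact (Polynomial.natDegree_mul_C_le _ _).trans (hF a c)

theorem natDegree_recPoly_le (j : ℕ) (a : Fin k) (b : Fin (blockSize k N j)) :
    (recPoly A B j a b).natDegree ≤ j := by
  induction j using Nat.strong_induction_on generalizing a with
  | _ j ih =>
  have hX : ∀ {i : ℕ} (a : Fin k) (b : Fin (blockSize k N i)),
      (recPoly A B i a b).natDegree ≤ i →
      (((X : ℂ[X]) • recPoly A B i) a b).natDegree ≤ i + 1 := by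
    intro i a b h
    rw [Matrix.smul_apply, smul_eq_mul, mul_comm]
    exact (Polynomial.natDegree_mul_le).trans (by gcongr; exact Polynomial.natDegree_X_le)
  have sub : ∀ {p q : ℂ[X]} {d : ℕ}, p.natDegree ≤ d → q.natDegree ≤ d →
      (p - q).natDegree ≤ d := fun hp hq =>
    (Polynomial.natDegree_sub_le _ _).trans (max_le hp hq)
  match j with
  | 0 =>
    simp only [recPoly, Matrix.submatrix_apply, Matrix.one_apply]
    split <;> simp
  | 1 =>
    rw [recPoly_succ, residual]
    refine natDegree_mul_map_C_le (fun a b => sub (hX a b (ih 0 (by omega) a b)) ?_) _ a b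
    exact natDegree_mul_map_C_le (fun a b => (ih 0 (by omega) a b).trans (by omega)) _ a b
  | j + 2 =>
    rw [recPoly_succ, residual]
    refine natDegree_mul_map_C_le
      (fun a b => sub (sub (hX a b (ih (j + 1) (by omega) a b)) ?_) ?_) _ a b
    · exact natDegree_mul_map_C_le (fun a b => (ih (j + 1) (by omega) a b).trans (by omega)) _ a b
    · exact natDegree_mul_map_C_le (fun a b => (ih j (by omega) a b).trans (by omega)) _ a b

/-- The polynomials and the coefficients `A'`, `B'` are only assumed correct as far as the residual
uses them. The lemma thus serves both for `recPoly` and for an unknown normalized system in the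
uniqueness induction. -/
theorem polyEval_residual (hk : 0 < k) (hkN : k ≤ N)
    {P : ∀ j, Matrix (Fin k) (Fin (blockSize k N j)) ℂ[X]}
    {A' : ∀ j, Matrix (Fin (blockSize k N j)) (Fin (blockSize k N j)) ℂ}
    {B' : ∀ j, Matrix (Fin (blockSize k N (j + 1))) (Fin (blockSize k N j)) ℂ}
    {j : ℕ}
    (hP : ∀ i ≤ j, polyEval (blockTridiag k N A B) (headCols hkN) (P i) = blockSel k N i)
    (hA : A' j = A j) (hB : ∀ i < j, B' i = B i) :
    polyEval (blockTridiag k N A B) (headCols hkN) (residual P A' B' j) =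
      blockSel k N (j + 1) * B j := by
  cases j with
  | zero =>
    rw [residual, polyEval_sub, polyEval_X_smul, polyEval_mul_map_C, hP 0 le_rfl, hA,
      blockTridiag_mul_blockSel_zero A B hk hkN, add_sub_cancel_left]
  | succ j =>
    rw [residual, polyEval_sub, polyEval_sub, polyEval_X_smul, polyEval_mul_map_C,
      polyEval_mul_map_C, hP (j + 1) le_rfl, hP j (by omega), hA, hB j (by omega),
      blockTridiag_mul_blockSel_succ A B hk hkN]
    abel

theorem polyEval_zero_block (J : Matrix (Fin N) (Fin N) ℂ) (hkN : k ≤ N) :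
    polyEval J (headCols hkN)
      ((1 : Matrix (Fin k) (Fin k) ℂ[X]).submatrix id (Fin.castLE (blockSize_le k N 0))) =
      blockSel k N 0 := by
  rw [polyEval_submatrix, polyEval_one, headCols, Matrix.submatrix_submatrix, blockSel]
  congr 1
  funext a
  exact Fin.ext (by simp [blockIndex])

/-- The residual of index `j` evaluates to block `j + 1` times `B j`, and the right inverse of the
full-rank `B j` removes that factor. Evaluation thereby turns orthonormality of the `P_j` into that
of the identity columns. -/
theorem polyEval_recPoly (hk : 0 < k) (hkN : k ≤ N)
    (hB : ∀ j, j + 1 < numBlocks k N → (B j).rank = blockSize k N (j + 1)) (j : ℕ) :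
    polyEval (blockTridiag k N A B) (headCols hkN) (recPoly A B j) = blockSel k N j := by
  induction j using Nat.strong_induction_on with
  | _ j ih =>
  cases j with
  | zero => simp only [recPoly]; exact polyEval_zero_block _ hkN
  | succ j =>
    by_cases hj : j + 1 < numBlocks k N
    · rw [recPoly_succ, polyEval_mul_map_C,
        polyEval_residual hk hkN (fun i hi => ih i (by omega)) rfl fun _ _ => rfl,
        Matrix.mul_assoc, mul_rightInv (hB j hj), Matrix.mul_one]
    · have := isEmpty_block hk hj
      ext r a
      exact this.elim a

/-- Each multiplication by the block tridiagonal matrix enlarges the support by at most one block.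
-/
theorem blockTridiag_pow_mul_headCols_apply (hk : 0 < k) (hkN : k ≤ N) (i : ℕ) {r : Fin N}
    (hr : (i + 1) * k ≤ r) (a : Fin k) :
    (blockTridiag k N A B ^ i * headCols hkN) r a = 0 := by
  induction i generalizing r with
  | zero =>
    rw [pow_zero, Matrix.one_mul, headCols, Matrix.submatrix_apply]
    refine Matrix.one_apply_ne fun h => ?_
    have := congrArg Fin.val h
    simp only [id, Fin.val_castLE] at this
    have := a.isLt
    omega
  | succ i ih =>
    rw [pow_succ', Matrix.mul_assoc, Matrix.mul_apply]
    refine Finset.sum_eq_zero fun c _ => ?_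
    by_cases hc : (i + 1) * k ≤ c
    · rw [ih hc, mul_zero]
    · rw [blockTridiag_apply_eq_zero A B hk hkN, zero_mul]
      have h1 : (c : ℕ) / k < i + 1 := (Nat.div_lt_iff_lt_mul hk).2 (not_le.1 hc)
      have h2 : i + 2 ≤ (r : ℕ) / k := (Nat.le_div_iff_mul_le hk).2 hr
      omega

/-- A vector polynomial of degree less than `m` is evaluated into the first `m` blocks. -/
theorem vecEval_apply_eq_zero (hk : 0 < k) (hkN : k ≤ N) {m : ℕ} {p : Fin k → ℂ[X]}
    (hp : ∀ a i, m ≤ i → (p a).coeff i = 0) {r : Fin N} (hr : m * k ≤ r) :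
    vecEval (blockTridiag k N A B) (headCols hkN) p r = 0 := by
  obtain ⟨x, rfl⟩ := exists_vecPoly_eq m p hp
  rw [vecEval_vecPoly, Matrix.mulVec, dotProduct]
  refine Finset.sum_eq_zero fun c _ => ?_
  rw [krylov, Matrix.of_apply, blockTridiag_pow_mul_headCols_apply hk hkN, zero_mul]
  exact le_trans (Nat.mul_le_mul_right _ c.divNat.isLt) hr

/-- The unit vector `e_r` is the value of a column of `recPoly` of index `r / k`, whose degree is
below `m`. -/
theorem single_mem_range_krylov (hk : 0 < k) (hkN : k ≤ N)
    (hB : ∀ j, j + 1 < numBlocks k N → (B j).rank = blockSize k N (j + 1)) {m : ℕ} {r : Fin N}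
    (hr : (r : ℕ) < m * k) :
    Pi.single r 1 ∈
      LinearMap.range (krylov (blockTridiag k N A B) (headCols hkN) m).mulVecLin := by
  obtain ⟨a, ha⟩ := exists_blockIndex_eq hk r
  have hm : (r : ℕ) / k < m := (Nat.div_lt_iff_lt_mul hk).2 hr
  obtain ⟨x, hx⟩ := exists_vecPoly_eq m (fun b => recPoly A B (r / k) b a) fun b i hi =>
    Polynomial.coeff_eq_zero_of_natDegree_lt
      (lt_of_le_of_lt (natDegree_recPoly_le _ _ _) (lt_of_lt_of_le hm hi))
  refine ⟨x, ?_⟩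
  rw [Matrix.mulVecLin_apply, ← vecEval_vecPoly, hx]
  funext l
  have := congrFun (congrFun (polyEval_recPoly (A := A) hk hkN hB (r / k)) l) a
  rw [polyEval_apply] at this
  rw [this, blockSel, Matrix.submatrix_apply, ha, id, Matrix.one_apply, Pi.single_apply]

theorem le_rank_krylov (hk : 0 < k) (hkN : k ≤ N)
    (hB : ∀ j, j + 1 < numBlocks k N → (B j).rank = blockSize k N (j + 1)) {m t : ℕ}
    (ht : t ≤ N) (htm : t ≤ m * k) :
    t ≤ (krylov (blockTridiag k N A B) (headCols hkN) m).rank := by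
  have hli : LinearIndependent ℂ
      (fun i : Fin t => (Pi.single (Fin.castLE ht i) 1 : Fin N → ℂ)) :=
    (Pi.linearIndependent_single_one (Fin N) ℂ).comp _ (Fin.castLE_injective ht)
  have := finrank_span_eq_card hli
  rw [Fintype.card_fin] at this
  rw [← this, Matrix.rank]
  apply Submodule.finrank_mono
  rw [Submodule.span_le]
  rintro _ ⟨i, rfl⟩
  exact single_mem_range_krylov hk hkN hB (lt_of_lt_of_le i.isLt htm)

theorem rank_krylov_of_lt (hk : 0 < k) (hkN : k ≤ N)
    (hB : ∀ j, j + 1 < numBlocks k N → (B j).rank = blockSize k N (j + 1)) {m : ℕ}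
    (hm : m < numBlocks k N) :
    (krylov (blockTridiag k N A B) (headCols hkN) m).rank = m * k := by
  refine le_antisymm ?_ (le_rank_krylov hk hkN hB ((lt_numBlocks_iff hk).1 hm).le le_rfl)
  simpa using (krylov (blockTridiag k N A B) (headCols hkN) m).rank_le_width

theorem le_numBlocks_mul (hk : 0 < k) : N ≤ numBlocks k N * k := by
  by_contra h
  exact lt_irrefl _ ((lt_numBlocks_iff hk).2 (not_le.1 h))

theorem rank_krylov_numBlocks (hk : 0 < k) (hkN : k ≤ N)
    (hB : ∀ j, j + 1 < numBlocks k N → (B j).rank = blockSize k N (j + 1)) :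
    (krylov (blockTridiag k N A B) (headCols hkN) (numBlocks k N)).rank = N := by
  refine le_antisymm ?_ (le_rank_krylov hk hkN hB le_rfl (le_numBlocks_mul hk))
  simpa using (krylov (blockTridiag k N A B) (headCols hkN) (numBlocks k N)).rank_le_height

theorem mulVec_injective_of_rank_eq {m n : ℕ} {M : Matrix (Fin m) (Fin n) ℂ} (h : M.rank = n) :
    Function.Injective M.mulVec := by
  have h1 := LinearMap.finrank_range_add_finrank_ker M.mulVecLin
  rw [← Matrix.rank, h, Module.finrank_fin_fun] at h1
  have h2 : LinearMap.ker M.mulVecLin = ⊥ := Submodule.finrank_eq_zero.1 (by omega)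
  exact LinearMap.ker_eq_bot.1 h2

/-- Below block `n` the Krylov matrix has full column rank, so evaluation is injective on
polynomials of degree less than `m`. -/
theorem eq_zero_of_vecEval_eq_zero (hk : 0 < k) (hkN : k ≤ N)
    (hB : ∀ j, j + 1 < numBlocks k N → (B j).rank = blockSize k N (j + 1)) {m : ℕ}
    (hm : m < numBlocks k N) {p : Fin k → ℂ[X]} (hp : ∀ a i, m ≤ i → (p a).coeff i = 0)
    (h0 : vecEval (blockTridiag k N A B) (headCols hkN) p = 0) : p = 0 := by
  obtain ⟨x, rfl⟩ := exists_vecPoly_eq m p hp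
  rw [vecEval_vecPoly] at h0
  rw [mulVec_injective_of_rank_eq (rank_krylov_of_lt hk hkN hB hm)
    (h0.trans (Matrix.mulVec_zero _).symm), map_zero]

end Recurrence

/-! ### Spectral measures of banded matrices belong to `ℳ_{k,N}` -/

section Membership

variable {k N : ℕ}

theorem rank_eq_card_of_mulVec_injective {m n : Type*} [Fintype m] [Fintype n]
    {M : Matrix m n ℂ} (h : Function.Injective M.mulVec) : M.rank = Fintype.card n := by
  have := LinearMap.finrank_range_of_inj (f := M.mulVecLin) h
  rw [Matrix.rank, this, Module.finrank_fintype_fun_eq_card]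

/-- A vector with vanishing head on which a Hermitian matrix with full Krylov matrix acts as a
real scalar is zero. -/
theorem eq_zero_of_head_eq_zero {J : Matrix (Fin N) (Fin N) ℂ} (hJ : J.IsHermitian)
    {E : Matrix (Fin N) (Fin k) ℂ} {d : ℕ} (hK : (krylov J E d).rank = N) {x : ℝ}
    {w : Fin N → ℂ} (hw : J *ᵥ w = (x : ℂ) • w) (h0 : Eᴴ *ᵥ w = 0) : w = 0 := by
  have hpow : ∀ i : ℕ, J ^ i *ᵥ w = (x : ℂ) ^ i • w := by
    intro i
    induction i with
    | zero => simp
    | succ i ih =>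
      rw [pow_succ', ← Matrix.mulVec_mulVec, ih, Matrix.mulVec_smul, hw, smul_smul, pow_succ]
  -- The adjoint of the Krylov matrix is injective, yet it kills `w`: its blocks give `(Jⁱ E)ᴴ w =
  -- xⁱ Eᴴ w = 0`.
  apply mulVec_injective_of_rank_eq (M := (krylov J E d)ᴴ) (by rw [rank_conjTranspose, hK])
  rw [Matrix.mulVec_zero]
  funext c
  have h1 : ((J ^ (c.divNat : ℕ) * E)ᴴ *ᵥ w) c.modNat = 0 := by
    rw [Matrix.conjTranspose_mul, (hJ.pow _).eq, ← Matrix.mulVec_mulVec, hpow,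
      Matrix.mulVec_smul, h0, smul_zero, Pi.zero_apply]
  exact h1

/-- The weight at `x` is `V Vᴴ`, where the columns of `V` are the heads of an orthonormal basis of
the eigenspace. A vector in that eigenspace with zero head is zero, so `V` has full column rank.
Summed over the eigenvalues, these ranks give total rank `N`. -/
theorem rank_sum_filter_eigenvectorHead (hkN : k ≤ N) {J : Matrix (Fin N) (Fin N) ℂ}
    (hJ : J.IsHermitian) {d : ℕ} (hK : (krylov J (headCols hkN) d).rank = N) (x : ℝ) :
    (∑ j with hJ.eigenvalues j = x, Matrix.vecMulVec (eigenvectorHead hkN hJ j)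
      (star (eigenvectorHead hkN hJ j))).rank =
      (Finset.univ.filter (hJ.eigenvalues · = x)).card := by
  let U : Matrix (Fin N) {j // hJ.eigenvalues j = x} ℂ :=
    (hJ.eigenvectorUnitary : Matrix (Fin N) (Fin N) ℂ).submatrix id Subtype.val
  have hU : Uᴴ * U = 1 := by
    have h : (hJ.eigenvectorUnitary : Matrix (Fin N) (Fin N) ℂ)ᴴ * hJ.eigenvectorUnitary = 1 :=
      Unitary.coe_star_mul_self hJ.eigenvectorUnitary
    have h2 := congrArg (fun M => M.submatrix (Subtype.val : {j // hJ.eigenvalues j = x} → Fin N)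
      (Subtype.val : {j // hJ.eigenvalues j = x} → Fin N)) h
    rw [Matrix.submatrix_one _ Subtype.val_injective] at h2
    exact h2
  have hJU : J * U = (x : ℂ) • U := by
    ext r j
    have h1 := congrFun (hJ.mulVec_eigenvectorBasis j) r
    rw [j.2] at h1
    simpa [U, Matrix.mul_apply, Matrix.mulVec, dotProduct, IsHermitian.eigenvectorUnitary_apply]
      using h1
  have hsum : ∑ j with hJ.eigenvalues j = x, Matrix.vecMulVec (eigenvectorHead hkN hJ j)
      (star (eigenvectorHead hkN hJ j)) =
      ((headCols hkN)ᴴ * U) * ((headCols hkN)ᴴ * U)ᴴ := by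
    have hV : ∀ a j, ((headCols hkN)ᴴ * U) a j = eigenvectorHead hkN hJ j a := by
      intro a j
      have : (headCols hkN)ᴴ * U = U.submatrix (Fin.castLE hkN) id := by
        rw [← Matrix.conjTranspose_conjTranspose U, ← Matrix.conjTranspose_mul, headCols,
          mul_one_submatrix]
        rfl
      rw [this]
      rfl
    rw [Finset.sum_subtype (p := fun j => hJ.eigenvalues j = x) _ (by simp)]
    ext a b
    rw [Matrix.sum_apply, Matrix.mul_apply]
    refine Finset.sum_congr rfl fun j _ => ?_
    rw [Matrix.conjTranspose_apply, hV, hV]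
    rfl
  rw [hsum, rank_self_mul_conjTranspose, rank_eq_card_of_mulVec_injective, Fintype.card_subtype]
  have key : ∀ c, ((headCols hkN)ᴴ * U) *ᵥ c = 0 → c = 0 := by
    intro c hc
    have hw : U *ᵥ c = 0 := by
      refine eq_zero_of_head_eq_zero hJ hK (x := x) ?_ ?_
      · rw [Matrix.mulVec_mulVec, hJU, Matrix.smul_mulVec]
      · rw [Matrix.mulVec_mulVec, hc]
    rw [← Matrix.one_mulVec c, ← hU, ← Matrix.mulVec_mulVec, hw, Matrix.mulVec_zero]
  intro c c' h
  rw [← sub_eq_zero]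
  apply key
  rw [Matrix.mulVec_sub]
  exact sub_eq_zero.2 h

theorem sum_eigenvectorHead (hkN : k ≤ N) {J : Matrix (Fin N) (Fin N) ℂ} (hJ : J.IsHermitian) :
    ∑ j, Matrix.vecMulVec (eigenvectorHead hkN hJ j) (star (eigenvectorHead hkN hJ j)) = 1 := by
  have h : (hJ.eigenvectorUnitary : Matrix (Fin N) (Fin N) ℂ) *
      (hJ.eigenvectorUnitary : Matrix (Fin N) (Fin N) ℂ)ᴴ = 1 :=
    Unitary.coe_mul_star_self hJ.eigenvectorUnitary
  rw [← Matrix.submatrix_one (Fin.castLE hkN) (Fin.castLE_injective hkN), ← h]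
  ext a b
  rw [Matrix.sum_apply, Matrix.submatrix_apply, Matrix.mul_apply]
  rfl

variable {A : ∀ j, Matrix (Fin (blockSize k N j)) (Fin (blockSize k N j)) ℂ}
  {B : ∀ j, Matrix (Fin (blockSize k N (j + 1))) (Fin (blockSize k N j)) ℂ}

theorem spectralMap_mem_measureClass (hk : 0 < k) (hkN : k ≤ N)
    (hA : ∀ j, j < numBlocks k N → (A j).IsHermitian)
    (hB : ∀ j, j + 1 < numBlocks k N → (B j).rank = blockSize k N (j + 1)) :
    spectralMap hkN (blockTridiag k N A B) ∈ measureClass k N := by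
  classical
  have hJ := blockTridiag_isHermitian (B := B) hA
  have hK := rank_krylov_numBlocks (A := A) hk hkN hB
  have hmod := isModel_spectralMap hkN hJ
  set v := eigenvectorHead hkN hJ with hv
  refine ⟨⟨Finset.univ.image hJ.eigenvalues, fun x => ∑ j with hJ.eigenvalues j = x,
    Matrix.vecMulVec (v j) (star (v j)), ?_, ?_, ?_, ?_⟩, ?_, ?_⟩
  · rw [spectralMap_eq hkN hJ, rankOneSum,
      ← Finset.sum_fiberwise_of_maps_to (t := Finset.univ.image hJ.eigenvalues)
        (g := hJ.eigenvalues) (fun j hj => Finset.mem_image_of_mem _ hj)]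
    refine Finset.sum_congr rfl fun x _ => ?_
    rw [dirac_sum]
    refine Finset.sum_congr rfl fun j hj => ?_
    rw [(Finset.mem_filter.1 hj).2]
  · intro x _
    exact Matrix.posSemidef_sum _ fun j _ => Matrix.posSemidef_vecMulVec_self_star _
  · rw [Finset.sum_fiberwise_of_maps_to (fun j hj => Finset.mem_image_of_mem _ hj)
      (fun j => Matrix.vecMulVec (v j) (star (v j)))]
    exact sum_eigenvectorHead hkN hJ
  · rw [Finset.sum_congr rfl fun x _ => rank_sum_filter_eigenvectorHead hkN hJ hK x,
      ← Finset.card_eq_sum_card_fiberwise fun j hj => Finset.mem_image_of_mem _ hj]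
    simp
  · intro d hd
    have := hmod.finrank_nullPolys d
    rw [rank_krylov_of_lt hk hkN hB hd] at this
    omega
  -- For `d = n - 1` the Krylov matrix has rank `N`, which leaves a kernel of dimension `n k - N =
  -- ℓ`.
  · intro d hd
    have := hmod.finrank_nullPolys d
    rw [hd, hK] at this
    rw [defect]
    omega

end Membership

/-! ### Banded matrices are the recurrence matrices of their spectral measures -/

section Existence

open scoped MatrixOrder in
theorem exists_posDef_mul_self {k : ℕ} {G : Matrix (Fin k) (Fin k) ℂ} (hG : G.PosDef) :
    ∃ R : Matrix (Fin k) (Fin k) ℂ, R.PosDef ∧ R * R = G := by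
  have hR : CFC.sqrt G * CFC.sqrt G = G := CFC.sqrt_mul_sqrt_self G hG.posSemidef.nonneg
  refine ⟨CFC.sqrt G, ?_, hR⟩
  have hu : IsUnit (CFC.sqrt G * CFC.sqrt G) := by rw [hR]; exact hG.isUnit
  exact ((CFC.sqrt_nonneg G).posSemidef.posDef_iff_isUnit).2 (isUnit_of_mul_isUnit_left hu)

variable {k N : ℕ} {A : ∀ j, Matrix (Fin (blockSize k N j)) (Fin (blockSize k N j)) ℂ}
  {B : ∀ j, Matrix (Fin (blockSize k N (j + 1))) (Fin (blockSize k N j)) ℂ}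

/-- The monic orthogonal polynomials of the spectral measure of a block tridiagonal matrix. -/
def monicPoly (A : ∀ j, Matrix (Fin (blockSize k N j)) (Fin (blockSize k N j)) ℂ)
    (B : ∀ j, Matrix (Fin (blockSize k N (j + 1))) (Fin (blockSize k N j)) ℂ) (hkN : k ≤ N)
    (j : ℕ) : Matrix (Fin k) (Fin k) ℂ[X] :=
  (X ^ j : ℂ[X]) • (1 : Matrix (Fin k) (Fin k) ℂ[X]) - ∑ i ∈ Finset.range j,
    recPoly A B i * ((blockSel k N i)ᴴ * (blockTridiag k N A B ^ j * headCols hkN)).map C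

theorem coeff_correction_eq_zero (hkN : k ≤ N) (j : ℕ) (a b : Fin k) {l : ℕ} (hl : j ≤ l) :
    ((∑ i ∈ Finset.range j, recPoly A B i *
      ((blockSel k N i)ᴴ * (blockTridiag k N A B ^ j * headCols hkN)).map C :
      Matrix (Fin k) (Fin k) ℂ[X]) a b).coeff l = 0 := by
  rw [Matrix.sum_apply, Polynomial.finsetSum_coeff]
  refine Finset.sum_eq_zero fun i hi => Polynomial.coeff_eq_zero_of_natDegree_lt ?_
  refine lt_of_le_of_lt (natDegree_mul_map_C_le (natDegree_recPoly_le i) _ a b) ?_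
  have := Finset.mem_range.1 hi
  omega

theorem coeff_monicPoly_self (hkN : k ≤ N) (j : ℕ) (a b : Fin k) :
    (monicPoly A B hkN j a b).coeff j = (1 : Matrix (Fin k) (Fin k) ℂ) a b := by
  rw [monicPoly, Matrix.sub_apply, Polynomial.coeff_sub, coeff_correction_eq_zero hkN j a b le_rfl,
    sub_zero, Matrix.smul_apply, Matrix.one_apply, Matrix.one_apply]
  split <;> simp

theorem coeff_monicPoly_of_lt (hkN : k ≤ N) {j l : ℕ} (hl : j < l) (a b : Fin k) :
    (monicPoly A B hkN j a b).coeff l = 0 := by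
  rw [monicPoly, Matrix.sub_apply, Polynomial.coeff_sub, coeff_correction_eq_zero hkN j a b hl.le,
    sub_zero, Matrix.smul_apply, Matrix.one_apply]
  split
  · simp [Polynomial.coeff_X_pow, hl.ne']
  · simp

/-- The terms subtracted from `X ^ j` in `monicPoly` evaluate to the components of `J ^ j E` in the
blocks before `j`, so those components cancel. -/
theorem conjTranspose_blockSel_mul_polyEval_monicPoly (hk : 0 < k) (hkN : k ≤ N)
    (hB : ∀ j, j + 1 < numBlocks k N → (B j).rank = blockSize k N (j + 1)) {i j : ℕ} (hij : i < j) :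
    (blockSel k N i)ᴴ *
      polyEval (blockTridiag k N A B) (headCols hkN) (monicPoly A B hkN j) = 0 := by
  rw [monicPoly, polyEval_sub, polyEval_sum, polyEval_X_pow_smul_one, Matrix.mul_sub,
    Matrix.mul_sum, Finset.sum_eq_single i]
  · rw [polyEval_mul_map_C, polyEval_recPoly hk hkN hB,
      ← Matrix.mul_assoc (blockSel k N i)ᴴ (blockSel k N i),
      conjTranspose_blockSel_mul_self, Matrix.one_mul, sub_self]
  · intro l _ hl
    rw [polyEval_mul_map_C, polyEval_recPoly hk hkN hB,
      ← Matrix.mul_assoc (blockSel k N i)ᴴ (blockSel k N l),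
      conjTranspose_blockSel_mul_of_ne hl.symm, Matrix.zero_mul]
  · intro h
    exact absurd (Finset.mem_range.2 hij) h

theorem polyEval_monicPoly_apply_eq_zero (hk : 0 < k) (hkN : k ≤ N)
    (hB : ∀ j, j + 1 < numBlocks k N → (B j).rank = blockSize k N (j + 1)) {j : ℕ} {r : Fin N}
    (hr : (r : ℕ) / k < j) (b : Fin k) :
    polyEval (blockTridiag k N A B) (headCols hkN) (monicPoly A B hkN j) r b = 0 := by
  obtain ⟨a, ha⟩ := exists_blockIndex_eq hk r
  have := congrFun (congrFun
    (conjTranspose_blockSel_mul_polyEval_monicPoly (A := A) hk hkN hB hr) a) b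
  rw [conjTranspose_blockSel_mul, Matrix.submatrix_apply, ha] at this
  exact this

/-- By degree, the value of index `i` is supported in the blocks up to `i`, while the value of index
`j` starts at block `j`; for `i < j` the supports are disjoint. -/
theorem polyEval_monicPoly_orthogonal (hk : 0 < k) (hkN : k ≤ N)
    (hB : ∀ j, j + 1 < numBlocks k N → (B j).rank = blockSize k N (j + 1)) {i j : ℕ} (hij : i < j) :
    (polyEval (blockTridiag k N A B) (headCols hkN) (monicPoly A B hkN i))ᴴ *
      polyEval (blockTridiag k N A B) (headCols hkN) (monicPoly A B hkN j) = 0 := by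
  ext a b
  rw [Matrix.mul_apply]
  refine Finset.sum_eq_zero fun r _ => ?_
  by_cases hr : (r : ℕ) / k < j
  · rw [polyEval_monicPoly_apply_eq_zero hk hkN hB hr, mul_zero]
  · rw [Matrix.conjTranspose_apply, polyEval_apply, vecEval_apply_eq_zero hk hkN (m := i + 1),
      star_zero, zero_mul]
    · exact fun c l hl => coeff_monicPoly_of_lt hkN hl c a
    · rw [← Nat.le_div_iff_mul_le hk]
      omega

/-- Multiplying the monic polynomial by the leading coefficient of `P_j` makes the difference have
degree less than `j`, so its value is supported before block `j`. Both terms vanish there, and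
evaluation is injective on such degrees. -/
theorem recPoly_eq_monicPoly_mul (hk : 0 < k) (hkN : k ≤ N)
    (hB : ∀ j, j + 1 < numBlocks k N → (B j).rank = blockSize k N (j + 1)) {j : ℕ}
    (hj : j < numBlocks k N) :
    recPoly A B j = monicPoly A B hkN j * ((recPoly A B j).map fun p => p.coeff j).map C := by
  set M := (recPoly A B j).map fun p => p.coeff j with hM
  rw [← sub_eq_zero]
  have hev : polyEval (blockTridiag k N A B) (headCols hkN)
      (recPoly A B j - monicPoly A B hkN j * M.map C) = blockSel k N j -
        polyEval (blockTridiag k N A B) (headCols hkN) (monicPoly A B hkN j) * M := by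
    rw [polyEval_sub, polyEval_mul_map_C, polyEval_recPoly hk hkN hB]
  suffices H : ∀ b, (fun a => (recPoly A B j - monicPoly A B hkN j * M.map C) a b) = 0 by
    exact Matrix.ext fun a b => congrFun (H b) a
  intro b
  have hcoeff : ∀ a i, j ≤ i →
      ((recPoly A B j - monicPoly A B hkN j * M.map C) a b).coeff i = 0 := by
    intro a i hi
    rw [Matrix.sub_apply, Polynomial.coeff_sub, Matrix.mul_apply, Polynomial.finsetSum_coeff]
    simp only [Matrix.map_apply, Polynomial.coeff_mul_C]
    rcases hi.eq_or_lt with rfl | hlt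
    · simp only [coeff_monicPoly_self]
      rw [← Matrix.mul_apply, Matrix.one_mul, hM, Matrix.map_apply, sub_self]
    · simp only [coeff_monicPoly_of_lt hkN hlt, zero_mul, Finset.sum_const_zero, sub_zero]
      exact Polynomial.coeff_eq_zero_of_natDegree_lt
        (lt_of_le_of_lt (natDegree_recPoly_le _ _ _) hlt)
  refine eq_zero_of_vecEval_eq_zero (A := A) hk hkN hB hj hcoeff ?_
  funext r
  by_cases hr : j * k ≤ r
  · exact vecEval_apply_eq_zero hk hkN hcoeff hr
  · have hr' : (r : ℕ) / k < j := (Nat.div_lt_iff_lt_mul hk).2 (not_le.1 hr)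
    have := congrFun (congrFun hev r) b
    rw [polyEval_apply] at this
    rw [this, Matrix.sub_apply, blockSel_apply_eq_zero hr'.ne, Matrix.mul_apply,
      Finset.sum_eq_zero fun c _ => by
        rw [polyEval_monicPoly_apply_eq_zero hk hkN hB hr', zero_mul]]
    simp

theorem isNormalizedOPS_recPoly (hk : 0 < k) (hkN : k ≤ N) {μ : MatMeasure k}
    (hμ : IsModel (blockTridiag k N A B) (headCols hkN) μ)
    (hB : ∀ j, j + 1 < numBlocks k N → (B j).rank = blockSize k N (j + 1))
    (hBu : ∀ j, j + 2 < numBlocks k N → IsUpperTriangularPos (B j))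
    (hBe : ∀ j, j + 2 = numBlocks k N → IsRowEchelonPos (B j)) :
    IsNormalizedOPS k N μ (recPoly A B) A B where
  zero := by simp only [recPoly]
  normalization := by
    refine ⟨monicPoly A B hkN, ⟨fun j _ => ⟨fun a b => ?_, ?_⟩, fun i _ j _ hij => ?_⟩,
      fun j hj => ?_⟩
    · rw [Polynomial.natDegree_le_iff_coeff_eq_zero]
      exact fun l hl => coeff_monicPoly_of_lt hkN hl a b
    · ext a b
      exact coeff_monicPoly_self hkN j a b
    · rw [hμ]
      rcases lt_or_gt_of_ne hij with h | h
      · exact polyEval_monicPoly_orthogonal hk hkN hB h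
      · rw [← Matrix.conjTranspose_conjTranspose (polyEval _ _ (monicPoly A B hkN j)),
          ← Matrix.conjTranspose_mul, polyEval_monicPoly_orthogonal hk hkN hB h,
          Matrix.conjTranspose_zero]
    · have hs := blockSize_eq hk hj
      set M := (recPoly A B j).map fun p => p.coeff j with hM
      have hP := recPoly_eq_monicPoly_mul (A := A) hk hkN hB (show j < numBlocks k N by omega)
      rw [← hM] at hP
      set G := polyEval (blockTridiag k N A B) (headCols hkN) (monicPoly A B hkN j) with hG
      have hGM : G * M = blockSel k N j := by
        rw [hG, ← polyEval_mul_map_C, ← hP, polyEval_recPoly hk hkN hB]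
      -- `M'` is the leading coefficient with its columns reindexed by `Fin k`. From `M'ᴴ γ M' = 1`
      -- it follows that `γ` is positive definite and, with `R` its positive square root, that `Q =
      -- R M'` is unitary; then `R⁻¹ Q = M'` is the required normalization.
      let M' : Matrix (Fin k) (Fin k) ℂ := M.submatrix id (Fin.cast hs.symm)
      have hM' : M'ᴴ * (Gᴴ * G) * M' = 1 := by
        have h1 : M'ᴴ * (Gᴴ * G) * M' =
            ((G * M)ᴴ * (G * M)).submatrix (Fin.cast hs.symm) (Fin.cast hs.symm) := by
          rw [Matrix.conjTranspose_mul]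
          simp only [Matrix.mul_assoc]
          rfl
        rw [h1, hGM, conjTranspose_blockSel_mul_self]
        exact Matrix.submatrix_one _ (Fin.cast_injective _)
      have hpd : (Gᴴ * G).PosDef := by
        apply Matrix.PosDef.conjTranspose_mul_self
        have hinv : (M' * (M'ᴴ * Gᴴ)) * G = 1 := by
          have := mul_eq_one_comm.1 hM'
          simpa only [Matrix.mul_assoc] using this
        intro x y hxy
        have hxy' : G *ᵥ x = G *ᵥ y := hxy
        rw [← Matrix.one_mulVec x, ← Matrix.one_mulVec y, ← hinv, ← Matrix.mulVec_mulVec, hxy',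
          Matrix.mulVec_mulVec]
      obtain ⟨R, hR, hRR⟩ := exists_posDef_mul_self hpd
      have hRdet : IsUnit R.det := (Matrix.isUnit_iff_isUnit_det R).1 hR.isUnit
      refine ⟨R, R * M', hR, by rw [hRR, hμ], ?_, ?_⟩
      · rw [Matrix.mem_unitaryGroup_iff', Matrix.star_eq_conjTranspose, Matrix.conjTranspose_mul,
          hR.1.eq, Matrix.mul_assoc, ← Matrix.mul_assoc R, hRR, ← Matrix.mul_assoc, hM']
      · rw [Matrix.nonsing_inv_mul_cancel_left _ _ hRdet]
        conv_lhs => rw [hP]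
        rfl
  diag j _ := by
    rw [hμ, polyEval_X_smul, polyEval_recPoly hk hkN hB,
      conjTranspose_blockSel_mul_blockTridiag_mul_blockSel hk hkN]
  subdiag j _ := by
    rw [hμ, polyEval_X_smul, polyEval_recPoly hk hkN hB, polyEval_recPoly hk hkN hB,
      conjTranspose_blockSel_succ_mul_blockTridiag_mul_blockSel hk hkN]
  subdiag_pos := hBu
  last_echelon := hBe
  last_norm j _ := by
    rw [hμ, polyEval_residual hk hkN (fun i _ => polyEval_recPoly hk hkN hB i) rfl fun _ _ => rfl,
      Matrix.conjTranspose_mul, Matrix.mul_assoc, ← Matrix.mul_assoc _ (blockSel k N (j + 1)),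
      conjTranspose_blockSel_mul_self, Matrix.one_mul]
  last_poly j _ := recPoly_succ j

end Existence

/-! ### Uniqueness of the recurrence matrix -/

section Uniqueness

variable {k N : ℕ} {A A' : ∀ j, Matrix (Fin (blockSize k N j)) (Fin (blockSize k N j)) ℂ}
  {B B' : ∀ j, Matrix (Fin (blockSize k N (j + 1))) (Fin (blockSize k N j)) ℂ}
  {P : ∀ j, Matrix (Fin k) (Fin (blockSize k N j)) ℂ[X]} {μ : MatMeasure k}

theorem IsNormalizedOPS.natDegree_le (h : IsNormalizedOPS k N μ P A' B') {j : ℕ}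
    (hj : j + 1 < numBlocks k N) (a : Fin k) (b : Fin (blockSize k N j)) :
    (P j a b).natDegree ≤ j := by
  obtain ⟨Pi, hPi, hP⟩ := h.normalization
  obtain ⟨R, Q, -, -, -, hPj⟩ := hP j hj
  rw [hPj]
  exact natDegree_mul_map_C_le (hPi.1 j (by omega)).1 _ a _

theorem IsNormalizedOPS.quasiInner_of_ne (h : IsNormalizedOPS k N μ P A' B')
    {T : Matrix (Fin N) (Fin N) ℂ} {E : Matrix (Fin N) (Fin k) ℂ} (hμ : IsModel T E μ) {i j : ℕ}
    (hi : i + 1 < numBlocks k N) (hj : j + 1 < numBlocks k N) (hij : i ≠ j) :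
    (polyEval T E (P i))ᴴ * polyEval T E (P j) = 0 := by
  obtain ⟨Pi, hPi, hP⟩ := h.normalization
  obtain ⟨R, Q, -, -, -, hPi'⟩ := hP i hi
  obtain ⟨R', Q', -, -, -, hPj'⟩ := hP j hj
  have h0 := hPi.2 i (by omega) j (by omega) hij
  rw [hμ] at h0
  rw [hPi', hPj', polyEval_submatrix, polyEval_submatrix, polyEval_mul_map_C, polyEval_mul_map_C,
    Matrix.conjTranspose_submatrix,
    ← Matrix.submatrix_mul _ _ _ _ _ Function.bijective_id,
    Matrix.conjTranspose_mul, Matrix.mul_assoc,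
    ← Matrix.mul_assoc _ (polyEval T E (Pi j)), h0, Matrix.zero_mul, Matrix.mul_zero]
  rfl

theorem IsNormalizedOPS.quasiInner_self (h : IsNormalizedOPS k N μ P A' B')
    {T : Matrix (Fin N) (Fin N) ℂ} {E : Matrix (Fin N) (Fin k) ℂ} (hμ : IsModel T E μ) {j : ℕ}
    (hj : j + 1 < numBlocks k N) : (polyEval T E (P j))ᴴ * polyEval T E (P j) = 1 := by
  obtain ⟨Pi, hPi, hP⟩ := h.normalization
  obtain ⟨R, Q, hR, hRR, hQ, hPj⟩ := hP j hj
  have hRdet : IsUnit R.det := (Matrix.isUnit_iff_isUnit_det R).1 hR.isUnit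
  rw [hμ] at hRR
  rw [Matrix.mem_unitaryGroup_iff', Matrix.star_eq_conjTranspose] at hQ
  rw [hPj, polyEval_submatrix, polyEval_mul_map_C, Matrix.conjTranspose_submatrix,
    ← Matrix.submatrix_mul _ _ _ _ _ Function.bijective_id,
    Matrix.conjTranspose_mul, Matrix.mul_assoc,
    ← Matrix.mul_assoc _ (polyEval T E (Pi j)), ← hRR, Matrix.conjTranspose_mul,
    Matrix.conjTranspose_nonsing_inv, hR.1.eq]
  have e : Qᴴ * R⁻¹ * (R * R * (R⁻¹ * Q)) = 1 := by
    rw [Matrix.mul_assoc R R, Matrix.mul_nonsing_inv_cancel_left _ _ hRdet, Matrix.mul_assoc,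
      Matrix.nonsing_inv_mul_cancel_left _ _ hRdet, hQ]
  rw [e]
  exact Matrix.submatrix_one _ (Fin.castLE_injective _)

/-- The values of the polynomials and the subdiagonal blocks have to be identified in a single
induction: the known values fix `A j` and the residual, which fix `B j`, which fixes the next value.
-/
theorem IsNormalizedOPS.polyEval_eq (hk : 0 < k) (hkN : k ≤ N)
    (hμ : IsModel (blockTridiag k N A B) (headCols hkN) μ)
    (hB : ∀ j, j + 1 < numBlocks k N → (B j).rank = blockSize k N (j + 1))
    (hBu : ∀ j, j + 2 < numBlocks k N → IsUpperTriangularPos (B j))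
    (hBe : ∀ j, j + 2 = numBlocks k N → IsRowEchelonPos (B j))
    (h : IsNormalizedOPS k N μ P A' B') (j : ℕ) (hj : j < numBlocks k N) :
    polyEval (blockTridiag k N A B) (headCols hkN) (P j) = blockSel k N j ∧
      ∀ i, i + 1 = j → B' i = B i := by
  induction j using Nat.strong_induction_on with
  | _ j ih =>
  cases j with
  | zero =>
    refine ⟨?_, fun i hi => by omega⟩
    rw [h.zero, polyEval_zero_block]
  | succ j =>
    have hPle : ∀ i ≤ j, polyEval (blockTridiag k N A B) (headCols hkN) (P i) = blockSel k N i :=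
      fun i hi => (ih i (by omega) (by omega)).1
    have hBlt : ∀ i < j, B' i = B i := fun i hi => (ih (i + 1) (by omega) (by omega)).2 i rfl
    have hAj : A' j = A j := by
      rw [h.diag j (by omega), hμ, polyEval_X_smul, hPle j le_rfl,
        conjTranspose_blockSel_mul_blockTridiag_mul_blockSel hk hkN]
    suffices H : polyEval (blockTridiag k N A B) (headCols hkN) (P (j + 1)) =
        blockSel k N (j + 1) ∧ B' j = B j from
      ⟨H.1, fun i hi => by obtain rfl : i = j := by omega
                           exact H.2⟩
    rcases (show j + 2 ≤ numBlocks k N by omega).eq_or_lt with hlast | hmid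
    -- Last step: the Gram matrix of the residual is `(B j)ᴴ * B j`, which determines the echelon
    -- matrix, and the right inverse recovers the last block.
    · have hres := polyEval_residual (A := A) (B := B) hk hkN hPle hAj hBlt
      have hBj : B' j = B j := by
        refine (h.last_echelon j hlast).eq_of_gram_eq (hBe j hlast) ?_
        rw [← h.last_norm j hlast, hμ, hres, Matrix.conjTranspose_mul, Matrix.mul_assoc,
          ← Matrix.mul_assoc _ (blockSel k N (j + 1)), conjTranspose_blockSel_mul_self,
          Matrix.one_mul]
      refine ⟨?_, hBj⟩
      rw [h.last_poly j hlast, polyEval_mul_map_C, hres, hBj, Matrix.mul_assoc,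
        mul_rightInv (hB j hj), Matrix.mul_one]
    -- Orthogonality removes the blocks of `F` before `j + 1` and the degree bound those after it,
    -- so `F` is block `j + 1` times a unitary `V`. Then `B' j = Vᴴ * B j` has the same Gram matrix
    -- as `B j`; both are echelon, hence equal, and cancelling `B j` by its right inverse gives `V =
    -- 1`.
    · set F := polyEval (blockTridiag k N A B) (headCols hkN) (P (j + 1)) with hF
      set V := (blockSel k N (j + 1))ᴴ * F with hV
      have hFV : F = blockSel k N (j + 1) * V := by
        refine blockSel_eq_of_forall hk fun i hi => ?_
        rw [← Matrix.mul_assoc]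
        rcases lt_trichotomy i (j + 1) with hlt | rfl | hgt
        · rw [conjTranspose_blockSel_mul_of_ne hlt.ne, Matrix.zero_mul, ← hPle i (by omega)]
          exact h.quasiInner_of_ne hμ (by omega) hmid hlt.ne
        · rw [conjTranspose_blockSel_mul_self, Matrix.one_mul]
        · rw [conjTranspose_blockSel_mul_of_ne hgt.ne', Matrix.zero_mul,
            conjTranspose_blockSel_mul]
          ext a b
          rw [Matrix.submatrix_apply, hF, polyEval_apply]
          refine vecEval_apply_eq_zero hk hkN (m := j + 2) (fun c l hl => ?_) ?_
          · exact Polynomial.coeff_eq_zero_of_natDegree_lt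
              (lt_of_le_of_lt (h.natDegree_le hmid _ _) hl)
          · exact le_trans (Nat.mul_le_mul_right k hgt) (Nat.le_add_right _ _)
      have hVV : Vᴴ * V = 1 := by
        have h1 := h.quasiInner_self hμ hmid
        rw [← hF, hFV, Matrix.conjTranspose_mul, Matrix.mul_assoc,
          ← Matrix.mul_assoc _ (blockSel k N (j + 1)), conjTranspose_blockSel_mul_self,
          Matrix.one_mul] at h1
        exact h1
      have hVB : B' j = Vᴴ * B j := by
        rw [h.subdiag j hmid, hμ, polyEval_X_smul, hPle j le_rfl, ← hF, hFV,
          Matrix.conjTranspose_mul, Matrix.mul_assoc,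
          conjTranspose_blockSel_succ_mul_blockTridiag_mul_blockSel hk hkN]
      have hle : blockSize k N (j + 1) ≤ blockSize k N j := by
        rw [blockSize_eq hk hj]; exact blockSize_le _ _ _
      have hBj : B' j = B j := by
        refine ((h.subdiag_pos j hmid).hasPivots hle).isRowEchelonPos.eq_of_gram_eq
          ((hBu j hmid).hasPivots hle).isRowEchelonPos ?_
        rw [hVB, Matrix.conjTranspose_mul, Matrix.conjTranspose_conjTranspose, Matrix.mul_assoc,
          ← Matrix.mul_assoc V, mul_eq_one_comm.1 hVV, Matrix.one_mul]
      refine ⟨?_, hBj⟩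
      have hV1 : Vᴴ = 1 := by
        rw [← Matrix.mul_one Vᴴ, ← mul_rightInv (hB j hj), ← Matrix.mul_assoc, ← hVB, hBj]
      rw [hFV, ← Matrix.conjTranspose_conjTranspose V, hV1, Matrix.conjTranspose_one,
        Matrix.mul_one]

theorem IsNormalizedOPS.blockTridiag_eq (hk : 0 < k) (hkN : k ≤ N)
    (hμ : IsModel (blockTridiag k N A B) (headCols hkN) μ)
    (hB : ∀ j, j + 1 < numBlocks k N → (B j).rank = blockSize k N (j + 1))
    (hBu : ∀ j, j + 2 < numBlocks k N → IsUpperTriangularPos (B j))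
    (hBe : ∀ j, j + 2 = numBlocks k N → IsRowEchelonPos (B j))
    (h : IsNormalizedOPS k N μ P A' B') : blockTridiag k N A' B' = blockTridiag k N A B := by
  have key := h.polyEval_eq hk hkN hμ hB hBu hBe
  rw [blockTridiag, blockTridiag]
  congr 1
  · refine Finset.sum_congr rfl fun j hj => ?_
    have hj := Finset.mem_range.1 hj
    rw [h.diag j hj, hμ, polyEval_X_smul, (key j hj).1,
      conjTranspose_blockSel_mul_blockTridiag_mul_blockSel hk hkN]
  · refine Finset.sum_congr rfl fun j hj => ?_
    have hj := Finset.mem_range.1 hj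
    rw [(key (j + 1) (by omega)).2 j rfl]

end Uniqueness

/-! ### Reduction to echelon form by unitary matrices -/

section Echelon

open InnerProductSpace

/-- Gram-Schmidt orthogonalization of the columns of a matrix of full row rank brings it to row
echelon form. -/
theorem exists_unitary_hasPivots {N m : ℕ} {K : Matrix (Fin N) (Fin m) ℂ} (hK : K.rank = N) :
    ∃ (U : Matrix (Fin N) (Fin N) ℂ) (p : Fin N → Fin m), Uᴴ * U = 1 ∧ HasPivots (Uᴴ * K) p ∧
      ∀ c, LinearIndependent ℂ (fun i : Set.Iic c => K.col i) → c ∈ Set.range p := by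
  classical
  let f : Fin m → EuclideanSpace ℂ (Fin N) := fun c => WithLp.toLp 2 (K.col c)
  let g := gramSchmidt ℂ f
  let S : Finset (Fin m) := Finset.univ.filter fun c => g c ≠ 0
  have horth : ∀ a b, a ≠ b → inner ℂ (g a) (g b) = 0 := fun a b h => gramSchmidt_orthogonal ℂ f h
  -- The nonzero Gram-Schmidt vectors are orthogonal and span the column space of `K`, which has
  -- dimension `N`. Their indices, in increasing order, are the pivots.
  have hcard : S.card = N := by
    have hli : LinearIndependent ℂ (fun c : S => g c) :=
      linearIndependent_of_ne_zero_of_inner_eq_zero (fun c => (Finset.mem_filter.1 c.2).2)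
        fun a b h => horth a b (Subtype.val_injective.ne h)
    have hspan : Submodule.span ℂ (Set.range fun c : S => g c) =
        Submodule.span ℂ (Set.range f) := by
      rw [← span_gramSchmidt ℂ f]
      refine le_antisymm (Submodule.span_mono ?_) (Submodule.span_le.2 ?_)
      · rintro _ ⟨c, rfl⟩
        exact ⟨c, rfl⟩
      · rintro _ ⟨c, rfl⟩
        by_cases hc : g c = 0
        · change g c ∈ _
          rw [hc]
          exact Submodule.zero_mem _
        · exact Submodule.subset_span ⟨⟨c, Finset.mem_filter.2 ⟨Finset.mem_univ _, hc⟩⟩, rfl⟩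
    have h1 := finrank_span_eq_card hli
    have h2 : Submodule.span ℂ (Set.range f) = (Submodule.span ℂ (Set.range K.col)).map
        (WithLp.linearEquiv 2 ℂ (Fin N → ℂ)).symm.toLinearMap := by
      rw [Submodule.map_span, ← Set.range_comp]
      rfl
    rw [hspan, h2, LinearEquiv.finrank_map_eq, ← Matrix.rank_eq_finrank_span_cols, hK,
      Fintype.card_coe] at h1
    exact h1.symm
  let e := S.orderIsoOfFin hcard
  let p : Fin N → Fin m := fun i => e i
  have hp0 : ∀ i, g (p i) ≠ 0 := fun i => (Finset.mem_filter.1 (e i).2).2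
  have hpm : StrictMono p := fun i j h => e.strictMono h
  let u : Fin N → EuclideanSpace ℂ (Fin N) := fun i => (‖g (p i)‖ : ℂ)⁻¹ • g (p i)
  let U : Matrix (Fin N) (Fin N) ℂ := Matrix.of fun r i => u i r
  have hn : ∀ i, (‖g (p i)‖ : ℂ) ≠ 0 := fun i => by simpa using hp0 i
  have hUK : ∀ i c, (Uᴴ * K) i c = (‖g (p i)‖ : ℂ)⁻¹ * inner ℂ (g (p i)) (f c) := by
    intro i c
    have : (Uᴴ * K) i c = inner ℂ (u i) (f c) := by
      rw [Matrix.mul_apply, PiLp.inner_apply]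
      refine Finset.sum_congr rfl fun r _ => ?_
      rw [RCLike.inner_apply, mul_comm]
      rfl
    rw [this, inner_smul_left, map_inv₀, Complex.conj_ofReal]
  refine ⟨U, p, ?_, ⟨hpm, fun i c hc => ?_, fun i => ?_⟩, fun c hc => ?_⟩
  · ext i j
    have : (Uᴴ * U) i j = inner ℂ (u i) (u j) := by
      rw [Matrix.mul_apply, PiLp.inner_apply]
      refine Finset.sum_congr rfl fun r _ => ?_
      rw [RCLike.inner_apply, mul_comm]
      rfl
    rw [this, inner_smul_left, inner_smul_right, map_inv₀, Complex.conj_ofReal]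
    by_cases hij : i = j
    · subst hij
      rw [inner_self_eq_norm_sq_to_K, Matrix.one_apply_eq]
      have := hn i
      simp only [Complex.coe_algebraMap]
      field_simp
    · rw [horth _ _ (hpm.injective.ne hij), Matrix.one_apply_ne hij, mul_zero, mul_zero]
  · rw [hUK, gramSchmidt_inv_triangular ℂ f hc, mul_zero]
  -- The column `f (p i)` is `g (p i)` plus a combination of earlier Gram-Schmidt vectors, so the
  -- pivot is the norm of `g (p i)`.
  · have h1 : inner ℂ (g (p i)) (f (p i)) = (‖g (p i)‖ : ℂ) ^ 2 := by
      rw [gramSchmidt_def'' ℂ f (p i), inner_add_right, inner_sum, Finset.sum_eq_zero, add_zero]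
      · exact inner_self_eq_norm_sq_to_K _
      · intro c hc
        rw [inner_smul_right, horth _ _ (Finset.mem_Iio.1 hc).ne', mul_zero]
    rw [hUK, h1]
    have : (‖g (p i)‖ : ℂ)⁻¹ * (‖g (p i)‖ : ℂ) ^ 2 = (‖g (p i)‖ : ℂ) := by
      have := hn i
      field_simp
    rw [this]
    exact_mod_cast norm_pos_iff.2 (hp0 i)
  · have hc0 : g c ≠ 0 := by
      apply gramSchmidt_ne_zero_coe
      exact hc.map' (WithLp.linearEquiv 2 ℂ (Fin N → ℂ)).symm.toLinearMap (LinearEquiv.ker _)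
    obtain ⟨i, hi⟩ := e.surjective ⟨c, Finset.mem_filter.2 ⟨Finset.mem_univ _, hc0⟩⟩
    exact ⟨i, congrArg Subtype.val hi⟩

end Echelon

/-! ### Recognizing banded matrices -/

section Banded

variable {k N : ℕ}

/-- For each row `r ≥ k`, `q r` is the column of the leading entry. The bound `hge` gives the
bandwidth, and `hlt` keeps the pivots of the last rows inside block `n - 2`. In the earlier rows
`heq` puts each pivot exactly `k` places to the left of the diagonal, which is the diagonal of the
subdiagonal block. -/
theorem mem_bandedClass_of_pivots (hk : 0 < k) (hkN : k ≤ N) {J : Matrix (Fin N) (Fin N) ℂ}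
    (hJ : J.IsHermitian) (q : Fin N → ℕ) (hmono : ∀ r s : Fin N, k ≤ r → r < s → q r < q s)
    (hlt : ∀ r : Fin N, k ≤ r → q r + k < numBlocks k N * k)
    (hge : ∀ r : Fin N, k ≤ r → (r : ℕ) ≤ q r + k)
    (heq : ∀ r : Fin N, k ≤ r → (r : ℕ) < (numBlocks k N - 1) * k → q r + k = r)
    (hzero : ∀ r c : Fin N, k ≤ r → (c : ℕ) < q r → J r c = 0)
    (hpos : ∀ r c : Fin N, k ≤ r → (c : ℕ) = q r → 0 < J r c) :
    J ∈ bandedClass k N := by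
  let A : ∀ j, Matrix (Fin (blockSize k N j)) (Fin (blockSize k N j)) ℂ :=
    fun j => (blockSel k N j)ᴴ * (J * blockSel k N j)
  let B : ∀ j, Matrix (Fin (blockSize k N (j + 1))) (Fin (blockSize k N j)) ℂ :=
    fun j => (blockSel k N (j + 1))ᴴ * (J * blockSel k N j)
  have hBapp : ∀ j a b, B j a b = J (blockIndex k N (j + 1) a) (blockIndex k N j b) := by
    intro j a b
    simp only [B]
    rw [conjTranspose_blockSel_mul, mul_blockSel]
    rfl
  have hidx : ∀ j (a : Fin (blockSize k N j)), (blockIndex k N j a : ℕ) = j * k + a :=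
    fun _ _ => rfl
  have hfar : ∀ i j, j + 1 < i → (blockSel k N i)ᴴ * (J * blockSel k N j) = 0 := by
    intro i j hij
    rw [conjTranspose_blockSel_mul, mul_blockSel]
    ext a b
    have hb : (b : ℕ) < k := lt_of_lt_of_le b.isLt (blockSize_le k N j)
    have h1 : (j + 2) * k ≤ i * k := Nat.mul_le_mul_right k hij
    have h2 : (j + 2) * k = j * k + k + k := by ring
    have hr : k ≤ (blockIndex k N i a : ℕ) := by rw [hidx]; omega
    refine hzero _ _ hr ?_
    have := hge _ hr
    simp only [id, hidx] at this ⊢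
    omega
  have hfar' : ∀ i j, i + 1 < j → (blockSel k N i)ᴴ * (J * blockSel k N j) = 0 := by
    intro i j hij
    have h := congrArg Matrix.conjTranspose (hfar j i hij)
    rw [Matrix.conjTranspose_mul, Matrix.conjTranspose_mul, hJ.eq,
      Matrix.conjTranspose_conjTranspose, Matrix.mul_assoc, Matrix.conjTranspose_zero] at h
    exact h
  have hA : ∀ j, (A j).IsHermitian := by
    intro j
    simp only [A, Matrix.IsHermitian]
    rw [Matrix.conjTranspose_mul, Matrix.conjTranspose_mul, hJ.eq,
      Matrix.conjTranspose_conjTranspose, Matrix.mul_assoc]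
  have hBH : ∀ j, (B j)ᴴ = (blockSel k N j)ᴴ * (J * blockSel k N (j + 1)) := by
    intro j
    simp only [B]
    rw [Matrix.conjTranspose_mul, Matrix.conjTranspose_mul, hJ.eq,
      Matrix.conjTranspose_conjTranspose, Matrix.mul_assoc]
  have hpiv : ∀ j, j + 1 < numBlocks k N → ∃ p, HasPivots (B j) p := by
    intro j hj
    have hbs := blockSize_eq hk hj
    have hjk : (j + 1) * k = j * k + k := by ring
    have hr : ∀ a : Fin (blockSize k N (j + 1)), k ≤ (blockIndex k N (j + 1) a : ℕ) := by
      intro a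
      rw [hidx]; omega
    have hlo : ∀ a, j * k ≤ q (blockIndex k N (j + 1) a) := by
      intro a
      have := hge _ (hr a)
      rw [hidx] at this
      omega
    have hup : ∀ a, q (blockIndex k N (j + 1) a) - j * k < blockSize k N j := by
      intro a
      have ha : (a : ℕ) < k := lt_of_lt_of_le a.isLt (blockSize_le k N (j + 1))
      rw [hbs]
      rcases (show j + 2 ≤ numBlocks k N by omega).eq_or_lt with hlast | hmid
      · have := hlt _ (hr a)
        rw [← hlast, show (j + 2) * k = j * k + k + k by ring] at this
        have := hlo a
        omega
      · have h3 : (j + 2) * k ≤ (numBlocks k N - 1) * k := Nat.mul_le_mul_right k (by omega)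
        rw [show (j + 2) * k = j * k + k + k by ring] at h3
        have := heq _ (hr a) (by rw [hidx]; omega)
        rw [hidx] at this
        omega
    refine ⟨fun a => ⟨q (blockIndex k N (j + 1) a) - j * k, hup a⟩, ?_, ?_, ?_⟩
    · intro a b hab
      have h1 := hmono (blockIndex k N (j + 1) a) (blockIndex k N (j + 1) b) (hr a)
        (Fin.lt_def.2 (by rw [hidx, hidx]; have := Fin.lt_def.1 hab; omega))
      have := hlo a
      rw [Fin.lt_def]
      change q _ - j * k < q _ - j * k
      omega
    · intro a c hc
      rw [hBapp]
      refine hzero _ _ (hr a) ?_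
      have hc' : (c : ℕ) < q (blockIndex k N (j + 1) a) - j * k := hc
      rw [hidx]
      omega
    · intro a
      rw [hBapp]
      refine hpos _ _ (hr a) ?_
      have := hlo a
      rw [hidx]
      change j * k + (q (blockIndex k N (j + 1) a) - j * k) = _
      omega
  refine ⟨A, B, fun j _ => hA j, fun j hj => ?_, fun j hj => ?_, fun j hj => ?_, ?_⟩
  · obtain ⟨p, hp⟩ := hpiv j hj
    exact hp.rank_eq
  · have h3 : (j + 2) * k ≤ (numBlocks k N - 1) * k := Nat.mul_le_mul_right k (by omega)
    rw [show (j + 2) * k = j * k + k + k by ring] at h3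
    have hjk : (j + 1) * k = j * k + k := by ring
    have key : ∀ a : Fin (blockSize k N (j + 1)), k ≤ (blockIndex k N (j + 1) a : ℕ) ∧
        q (blockIndex k N (j + 1) a) = j * k + a := by
      intro a
      have ha : (a : ℕ) < k := lt_of_lt_of_le a.isLt (blockSize_le k N (j + 1))
      have hr : k ≤ (blockIndex k N (j + 1) a : ℕ) := by rw [hidx]; omega
      have := heq _ hr (by rw [hidx]; omega)
      rw [hidx] at this
      exact ⟨hr, by omega⟩
    refine ⟨fun a b hab => ?_, fun a b hab => ?_⟩
    · rw [hBapp]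
      exact hzero _ _ (key a).1 (by rw [(key a).2, hidx]; omega)
    · rw [hBapp]
      exact hpos _ _ (key a).1 (by rw [(key a).2, hidx]; omega)
  · obtain ⟨p, hp⟩ := hpiv j (by omega)
    exact hp.isRowEchelonPos
  · have hcol : ∀ j, J * blockSel k N j = blockTridiag k N A B * blockSel k N j := by
      intro j
      refine blockSel_eq_of_forall hk fun i _ => ?_
      cases j with
      | zero =>
        rw [blockTridiag_mul_blockSel_zero A B hk hkN, Matrix.mul_add, ← Matrix.mul_assoc _ _ (A 0),
          ← Matrix.mul_assoc _ _ (B 0)]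
        rcases (show i = 0 ∨ i = 1 ∨ 1 < i by omega) with rfl | rfl | h
        · rw [conjTranspose_blockSel_mul_self,
            conjTranspose_blockSel_mul_of_ne (show 0 ≠ 1 by omega), Matrix.one_mul,
            Matrix.zero_mul, add_zero]
        · rw [conjTranspose_blockSel_mul_self,
            conjTranspose_blockSel_mul_of_ne (show 1 ≠ 0 by omega), Matrix.zero_mul, zero_add]
          exact (Matrix.one_mul (B 0)).symm
        · rw [hfar i 0 h, conjTranspose_blockSel_mul_of_ne (show i ≠ 0 by omega),
            conjTranspose_blockSel_mul_of_ne (show i ≠ 1 by omega), Matrix.zero_mul,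
            Matrix.zero_mul, add_zero]
      | succ j =>
        rw [blockTridiag_mul_blockSel_succ A B hk hkN, Matrix.mul_add, Matrix.mul_add,
          ← Matrix.mul_assoc _ _ (A (j + 1)), ← Matrix.mul_assoc _ _ (B (j + 1)),
          ← Matrix.mul_assoc _ _ (B j)ᴴ]
        rcases (show i = j + 1 ∨ i = j + 2 ∨ i = j ∨ j + 1 + 1 < i ∨ i + 1 < j + 1 by omega) with
          rfl | rfl | rfl | h | h
        · rw [conjTranspose_blockSel_mul_self,
            conjTranspose_blockSel_mul_of_ne (show j + 1 ≠ j + 2 by omega),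
            conjTranspose_blockSel_mul_of_ne (show j + 1 ≠ j by omega), Matrix.one_mul,
            Matrix.zero_mul, Matrix.zero_mul, add_zero, add_zero]
        · rw [conjTranspose_blockSel_mul_self,
            conjTranspose_blockSel_mul_of_ne (show j + 2 ≠ j + 1 by omega),
            conjTranspose_blockSel_mul_of_ne (show j + 2 ≠ j by omega),
            Matrix.zero_mul, Matrix.zero_mul, add_zero, zero_add]
          exact (Matrix.one_mul (B (j + 1))).symm
        · rw [conjTranspose_blockSel_mul_self,
            conjTranspose_blockSel_mul_of_ne (show i ≠ i + 1 by omega),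
            conjTranspose_blockSel_mul_of_ne (show i ≠ i + 2 by omega),
            Matrix.zero_mul, Matrix.zero_mul, add_zero, zero_add, Matrix.one_mul, hBH]
        · rw [hfar i (j + 1) h, conjTranspose_blockSel_mul_of_ne (show i ≠ j + 1 by omega),
            conjTranspose_blockSel_mul_of_ne (show i ≠ j + 2 by omega),
            conjTranspose_blockSel_mul_of_ne (show i ≠ j by omega), Matrix.zero_mul,
            Matrix.zero_mul, Matrix.zero_mul, add_zero, add_zero]
        · rw [hfar' i (j + 1) h, conjTranspose_blockSel_mul_of_ne (show i ≠ j + 1 by omega),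
            conjTranspose_blockSel_mul_of_ne (show i ≠ j + 2 by omega),
            conjTranspose_blockSel_mul_of_ne (show i ≠ j by omega), Matrix.zero_mul,
            Matrix.zero_mul, Matrix.zero_mul, add_zero, add_zero]
    -- The comparison criterion works with row blocks, so the column identities `hcol` are turned
    -- into row identities by taking adjoints of the two Hermitian matrices.
    have hT : (blockTridiag k N A B).IsHermitian := blockTridiag_isHermitian fun j _ => hA j
    refine blockSel_eq_of_forall hk fun j _ => ?_
    have := congrArg Matrix.conjTranspose (hcol j)
    rw [Matrix.conjTranspose_mul, Matrix.conjTranspose_mul, hJ.eq, hT.eq] at this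
    exact this

end Banded

/-! ### Block Lanczos reduction -/

section Lanczos

variable {k N : ℕ}

theorem krylov_apply (T : Matrix (Fin N) (Fin N) ℂ) (E : Matrix (Fin N) (Fin k) ℂ) (d : ℕ)
    (r : Fin N) (c : Fin (d * k)) :
    krylov T E d r c = (T ^ ((c : ℕ) / k) * E) r ⟨(c : ℕ) % k, c.modNat.isLt⟩ := rfl

/-- Multiplication by `T` shifts the Krylov columns by one block, that is, by `k` places. -/
theorem mul_krylov_apply (hk : 0 < k) (T : Matrix (Fin N) (Fin N) ℂ) (E : Matrix (Fin N) (Fin k) ℂ)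
    (d : ℕ) (r : Fin N) (c c' : Fin (d * k)) (h : (c' : ℕ) = c + k) :
    (T * krylov T E d) r c = krylov T E d r c' := by
  have h1 : (T * krylov T E d) r c =
      (T * (T ^ ((c : ℕ) / k) * E)) r ⟨(c : ℕ) % k, c.modNat.isLt⟩ := rfl
  have hd : (c' : ℕ) / k = c / k + 1 := by rw [h, Nat.add_div_right _ hk]
  have hm : (c' : ℕ) % k = c % k := by rw [h, Nat.add_mod_right]
  rw [h1, krylov_apply, ← Matrix.mul_assoc, ← pow_succ', ← hd]
  simp only [hm]

theorem isRowEchelonPos_headCols (hkN : k ≤ N) : IsRowEchelonPos (headCols hkN) := by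
  have happ : ∀ i j, headCols hkN i j = if (i : ℕ) = j then 1 else 0 := by
    intro i j
    rw [headCols, Matrix.submatrix_apply, Matrix.one_apply]
    simp [Fin.ext_iff]
  refine ⟨fun i₁ i₂ hi j hj => ?_, fun i c hc => ?_⟩
  · rw [happ]
    split_ifs with h
    · have hlt : (i₁ : ℕ) < j := by rw [← h]; exact hi
      have := hj ⟨i₁, hlt.trans j.isLt⟩ hlt
      rw [happ] at this
      simp at this
    · rfl
  · have := hc.2
    rw [happ] at this ⊢
    split_ifs at this ⊢ with h
    · exact one_pos
    · exact absurd rfl this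

theorem conjTranspose_headCols_mul_self (hkN : k ≤ N) : (headCols hkN)ᴴ * headCols hkN = 1 := by
  have : (headCols hkN)ᴴ * headCols hkN =
      ((1 : Matrix (Fin N) (Fin N) ℂ)ᴴ * (1 : Matrix (Fin N) (Fin N) ℂ)).submatrix
        (Fin.castLE hkN) (Fin.castLE hkN) := rfl
  rw [this, Matrix.conjTranspose_one, Matrix.mul_one]
  exact Matrix.submatrix_one _ (Fin.castLE_injective hkN)

theorem IsRowEchelonPos.submatrix_castLE {r s t : ℕ} {M : Matrix (Fin r) (Fin s) ℂ}
    (hM : IsRowEchelonPos M) (h : t ≤ s) : IsRowEchelonPos (M.submatrix id (Fin.castLE h)) := by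
  have lift : ∀ (i : Fin r) (c : Fin t),
      (∀ j < c, M.submatrix id (Fin.castLE h) i j = 0) → ∀ j < Fin.castLE h c, M i j = 0 := by
    intro i c hc j hj
    have hjc : (j : ℕ) < c := hj
    exact hc ⟨j, hjc.trans c.isLt⟩ hjc
  exact ⟨fun i₁ i₂ hi c hc => hM.1 hi (lift i₁ c hc),
    fun i c hc => hM.2 i _ ⟨lift i c hc.1, hc.2⟩⟩

theorem HasPivots.le_apply {r s : ℕ} {M : Matrix (Fin r) (Fin s) ℂ} {p : Fin r → Fin s}
    (h : HasPivots M p) (i : Fin r) : (i : ℕ) ≤ p i := by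
  obtain ⟨v, hv⟩ := i
  induction v with
  | zero => exact Nat.zero_le _
  | succ v ih =>
    have h1 := ih (by omega)
    have h2 := h.strictMono (show (⟨v, by omega⟩ : Fin r) < ⟨v + 1, hv⟩ from Nat.lt_succ_self v)
    exact lt_of_le_of_lt h1 h2

/-- Column `i` is the pivot of some row `i'`, and `i' ≤ p i' = i`. If `i' < i`, induction would give
`p i' = i'`, a contradiction. -/
theorem HasPivots.apply_eq {r s : ℕ} {M : Matrix (Fin r) (Fin s) ℂ} {p : Fin r → Fin s}
    (h : HasPivots M p) {m : ℕ} (hm : ∀ c : Fin s, (c : ℕ) < m → c ∈ Set.range p) (i : Fin r)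
    (hi : (i : ℕ) < m) (his : (i : ℕ) < s) : (p i : ℕ) = i := by
  induction i using WellFoundedLT.induction with
  | ind i ih =>
  obtain ⟨i', hi'⟩ := hm ⟨i, his⟩ hi
  have hle := h.le_apply i'
  rw [hi'] at hle
  rcases lt_or_eq_of_le (show i' ≤ i from hle) with hlt | rfl
  · have h1 := ih i' hlt (lt_trans hlt hi) (lt_trans hlt his)
    rw [hi'] at h1
    exact absurd h1 (ne_of_gt hlt)
  · rw [hi']

/-- Gram-Schmidt on the Krylov columns gives `U` with `R = Uᴴ K` in echelon form. The matrix `J = Uᴴ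
T U` sends column `c` of `R` to column `c + k`, and the first `(n - 1) k` columns of `R` are upper
triangular with positive diagonal. Hence the leading entry of row `r ≥ k` of `J` lies in column `p r
- k`, a shift of the pivot of `R`, and is positive. -/
theorem exists_unitary_conj_mem_bandedClass (hk : 0 < k) (hkN : k ≤ N)
    {T : Matrix (Fin N) (Fin N) ℂ} (hT : T.IsHermitian) {E : Matrix (Fin N) (Fin k) ℂ}
    (hE : Eᴴ * E = 1) (hK : (krylov T E (numBlocks k N)).rank = N)
    (hK' : (krylov T E (numBlocks k N - 1)).rank = (numBlocks k N - 1) * k) :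
    ∃ U : Matrix (Fin N) (Fin N) ℂ, Uᴴ * U = 1 ∧ Uᴴ * T * U ∈ bandedClass k N ∧
      Uᴴ * E = headCols hkN := by
  set n := numBlocks k N with hn
  have hn0 : 0 < n := (lt_numBlocks_iff hk).2 (by omega)
  have hnN : (n - 1) * k < N := (lt_numBlocks_iff hk).1 (by omega)
  have hnk : n * k = (n - 1) * k + k := by
    obtain ⟨t, ht⟩ : ∃ t, n = t + 1 := ⟨n - 1, by omega⟩
    rw [ht, Nat.add_sub_cancel]; ring
  obtain ⟨U, p, hU, hpiv, hrange⟩ := exists_unitary_hasPivots hK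
  have hU' : U * Uᴴ = 1 := mul_eq_one_comm.1 hU
  set R := Uᴴ * krylov T E n with hR
  have hJ : (Uᴴ * T * U).IsHermitian := by
    rw [Matrix.IsHermitian, Matrix.conjTranspose_mul, Matrix.conjTranspose_mul, hT.eq,
      Matrix.conjTranspose_conjTranspose, Matrix.mul_assoc]
  -- By `hK'` the first `(n - 1) * k` Krylov columns are linearly independent, so each of them is a
  -- pivot column.
  have hrange' : ∀ c : Fin (n * k), (c : ℕ) < (n - 1) * k → c ∈ Set.range p := by
    intro c hc
    apply hrange
    have hli : LinearIndependent ℂ (krylov T E (n - 1)).col :=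
      Matrix.mulVec_injective_iff.1 (mulVec_injective_of_rank_eq hK')
    exact hli.comp (fun i : Set.Iic c => (⟨i, lt_of_le_of_lt i.2 hc⟩ : Fin ((n - 1) * k)))
      fun i j hij => Subtype.ext (Fin.ext (Fin.mk.inj_iff.1 hij))
  have hpe : ∀ i : Fin N, (i : ℕ) < (n - 1) * k → (p i : ℕ) = i :=
    fun i hi => hpiv.apply_eq hrange' i hi (by omega)
  have hpge := hpiv.le_apply
  have hrec : ∀ (r : Fin N) (c c' : Fin (n * k)), (c' : ℕ) = c + k →
      ∑ i, (Uᴴ * T * U) r i * R i c = R r c' := by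
    intro r c c' h
    rw [← Matrix.mul_apply, hR, ← Matrix.mul_assoc, Matrix.mul_assoc (Uᴴ * T), hU', Matrix.mul_one,
      Matrix.mul_assoc, Matrix.mul_apply, Matrix.mul_apply]
    exact Finset.sum_congr rfl fun l _ => by rw [mul_krylov_apply hk T E n l c c' h]
  -- Column `c` of `R` vanishes below row `c`. If row `r` of `J` vanishes before `c`, only the term
  -- `i = c` survives in `hrec`.
  have hstep : ∀ (r c : Fin N) (hc : (c : ℕ) < (n - 1) * k),
      (∀ i < c, (Uᴴ * T * U) r i = 0) →
      (Uᴴ * T * U) r c * R c ⟨c, by omega⟩ = R r ⟨c + k, by omega⟩ := by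
    intro r c hc h0
    rw [← hrec r ⟨c, by omega⟩ ⟨c + k, by omega⟩ rfl, Finset.sum_eq_single c]
    · intro i _ hi
      rcases lt_or_gt_of_ne hi with hlt | hgt
      · rw [h0 i hlt, zero_mul]
      · rw [hpiv.zero i, mul_zero]
        exact Fin.lt_def.2 (lt_of_lt_of_le (show (c : ℕ) < i from hgt) (hpge i))
    · simp
  have hRpos : ∀ (c : Fin N) (hc : (c : ℕ) < (n - 1) * k), 0 < R c ⟨c, by omega⟩ := by
    intro c hc
    have := hpiv.pos c
    rwa [show p c = ⟨c, by omega⟩ from Fin.ext (hpe c hc)] at this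
  have hpk : ∀ r : Fin N, k ≤ r → k ≤ (p r : ℕ) := fun r hr => hr.trans (hpge r)
  have hzero : ∀ r c : Fin N, k ≤ r → (c : ℕ) < (p r : ℕ) - k → (Uᴴ * T * U) r c = 0 := by
    intro r c hr
    induction c using WellFoundedLT.induction with
    | ind c ih =>
    intro hc
    have hplt := (p r).isLt
    have hc' : (c : ℕ) < (n - 1) * k := by omega
    have h := hstep r c hc' fun i hi => ih i hi (lt_trans hi hc)
    rw [hpiv.zero r _ (show (⟨c + k, by omega⟩ : Fin (n * k)) < p r from
      Fin.lt_def.2 (by change (c : ℕ) + k < p r; omega))] at h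
    exact (mul_eq_zero.1 h).resolve_right (hRpos c hc').ne'
  refine ⟨U, hU, ?_, ?_⟩
  · refine mem_bandedClass_of_pivots hk hkN hJ (fun r => (p r : ℕ) - k) ?_ ?_ ?_ ?_ hzero ?_
    · intro r s hr hrs
      have h1 : (p r : ℕ) < p s := hpiv.strictMono hrs
      have := hpk r hr
      change (p r : ℕ) - k < (p s : ℕ) - k
      omega
    · intro r hr
      have := hpk r hr
      have := (p r).isLt
      change (p r : ℕ) - k + k < n * k
      omega
    · intro r hr
      have := hpge r
      change (r : ℕ) ≤ (p r : ℕ) - k + k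
      omega
    · intro r hr hlt
      have := hpe r hlt
      change (p r : ℕ) - k + k = r
      omega
    · intro r c hr hc
      have hc : (c : ℕ) = (p r : ℕ) - k := hc
      have := hpk r hr
      have hplt := (p r).isLt
      have hc' : (c : ℕ) < (n - 1) * k := by omega
      have h := hstep r c hc' fun i hi => hzero r i hr (by rw [← hc]; exact hi)
      rw [show (⟨c + k, by omega⟩ : Fin (n * k)) = p r from
        Fin.ext (by change (c : ℕ) + k = p r; omega)] at h
      have hd := hRpos c hc'
      have : (Uᴴ * T * U) r c = R r (p r) * (R c ⟨c, by omega⟩)⁻¹ := by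
        rw [← h, mul_inv_cancel_right₀ hd.ne']
      rw [this]
      exact mul_pos (hpiv.pos r) (inv_pos.2 hd)
  · have hkle : k ≤ n * k := by omega
    have h1 : Uᴴ * E = R.submatrix id (Fin.castLE hkle) := by
      ext i a
      rw [Matrix.submatrix_apply, hR, Matrix.mul_apply, Matrix.mul_apply]
      refine Finset.sum_congr rfl fun l _ => ?_
      rw [krylov_apply]
      have ha : ((Fin.castLE hkle a : Fin (n * k)) : ℕ) = a := rfl
      simp only [ha, Nat.div_eq_of_lt a.isLt, Nat.mod_eq_of_lt a.isLt, pow_zero, Matrix.one_mul, id]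
    -- Both `Uᴴ E` and the first identity columns are echelon with positive pivots and have the
    -- identity as Gram matrix, so they coincide.
    refine IsRowEchelonPos.eq_of_gram_eq ?_ (isRowEchelonPos_headCols hkN) ?_
    · rw [h1]
      exact hpiv.isRowEchelonPos.submatrix_castLE hkle
    · rw [conjTranspose_headCols_mul_self, Matrix.conjTranspose_mul,
        Matrix.conjTranspose_conjTranspose, Matrix.mul_assoc, ← Matrix.mul_assoc U, hU',
        Matrix.one_mul, hE]

/-- Total mass `I` makes `E` an isometry in the diagonal model of `μ`, and the null space dimensions
give the two Krylov ranks that the Lanczos reduction needs. The resulting banded matrix models both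
`μ` and its own spectral measure, so the two measures are equal. -/
theorem exists_mem_bandedClass_spectralMap_eq (hk : 0 < k) (hkN : k ≤ N) {μ : MatMeasure k}
    (hμ : μ ∈ measureClass k N) : ∃ J ∈ bandedClass k N, spectralMap hkN J = μ := by
  obtain ⟨⟨s, W, rfl, hW, hsum, hrank⟩, hlow, htop⟩ := hμ
  have hn0 : 0 < numBlocks k N := (lt_numBlocks_iff hk).2 (by omega)
  obtain ⟨lam, v, hlv⟩ := exists_eq_rankOneSum s W hW hrank
  have hmod := isModel_rankOneSum lam v
  have hE : (Matrix.of fun l a => star (v l a))ᴴ * (Matrix.of fun l a => star (v l a)) = 1 := by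
    have h1 := hmod (1 : Matrix (Fin k) (Fin k) ℂ[X]) (1 : Matrix (Fin k) (Fin k) ℂ[X])
    rw [polyEval_one] at h1
    rw [← h1, ← hlv, ← hsum]
    ext a b
    rw [quasiInner_sum_dirac, Matrix.sum_apply]
    refine Finset.sum_congr rfl fun x _ => ?_
    rw [Finset.sum_eq_single a, Finset.sum_eq_single b]
    · simp
    · intro d _ hd
      simp [Matrix.one_apply_ne hd]
    · simp
    · intro c _ hc
      simp [Matrix.one_apply_ne hc]
    · simp
  have hT : (Matrix.diagonal fun l => (lam l : ℂ)).IsHermitian := by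
    rw [Matrix.isHermitian_diagonal_iff]
    intro l
    exact Complex.conj_ofReal _
  have hK : (krylov (Matrix.diagonal fun l => (lam l : ℂ)) (Matrix.of fun l a => star (v l a))
      (numBlocks k N)).rank = N := by
    have h1 := hmod.finrank_nullPolys (numBlocks k N - 1)
    rw [← hlv, htop _ (by omega), Nat.sub_add_cancel hn0, defect] at h1
    have := le_numBlocks_mul (N := N) hk
    omega
  have hK' : (krylov (Matrix.diagonal fun l => (lam l : ℂ)) (Matrix.of fun l a => star (v l a))
      (numBlocks k N - 1)).rank = (numBlocks k N - 1) * k := by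
    -- For `n = 1` the Krylov matrix has no columns and there is no condition to use; otherwise the
    -- rank comes from `𝒩_{n-2} = 0`.
    rcases Nat.eq_zero_or_pos (numBlocks k N - 1) with h0 | hpos
    · have := (krylov (Matrix.diagonal fun l => (lam l : ℂ))
        (Matrix.of fun l a => star (v l a)) (numBlocks k N - 1)).rank_le_width
      have hz : (numBlocks k N - 1) * k = 0 := by rw [h0, zero_mul]
      omega
    · have h1 := hmod.finrank_nullPolys (numBlocks k N - 2)
      rw [← hlv, hlow _ (by omega), zero_add,
        show numBlocks k N - 2 + 1 = numBlocks k N - 1 by omega] at h1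
      exact h1
  obtain ⟨U, hU, hJ, hUE⟩ := exists_unitary_conj_mem_bandedClass hk hkN hT hE hK hK'
  refine ⟨_, hJ, ?_⟩
  have hJH : (Uᴴ * (Matrix.diagonal fun l => (lam l : ℂ)) * U).IsHermitian := by
    rw [Matrix.IsHermitian, Matrix.conjTranspose_mul, Matrix.conjTranspose_mul, hT.eq,
      Matrix.conjTranspose_conjTranspose, Matrix.mul_assoc]
  have h1 := hmod.conj (U := Uᴴ)
    (by rw [Matrix.conjTranspose_conjTranspose]; exact mul_eq_one_comm.1 hU)
  rw [Matrix.conjTranspose_conjTranspose, hUE] at h1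
  have h2 := isModel_spectralMap hkN hJH
  rw [spectralMap_eq hkN hJH] at h2
  rw [hlv, spectralMap_eq hkN hJH]
  exact rankOneSum_eq_of_isModel h2 h1

end Lanczos

end BandedSpectral

end

/-- The first conjunct says that the recurrence matrix of every `μ ∈ ℳ_{k,N}` exists and is unique,
so that `ψ` is well defined; the others say that `ψ` maps `ℳ_{k,N}` to `𝒥_{k,N}`, that
`φ (ψ μ) = μ`, and that `φ` is a bijection from `𝒥_{k,N}` onto `ℳ_{k,N}` with inverse `ψ`. -/
theorem mainTheorem2 (k N : ℕ) (hk : 0 < k) (hkN : k ≤ N) :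
    (∀ μ ∈ BandedSpectral.measureClass k N,
      ∃! J : Matrix (Fin N) (Fin N) ℂ, BandedSpectral.IsRecurrenceMatrix k N μ J) ∧
    (∀ μ ∈ BandedSpectral.measureClass k N,
      BandedSpectral.inverseSpectralMap k N μ ∈ BandedSpectral.bandedClass k N ∧
      BandedSpectral.spectralMap hkN (BandedSpectral.inverseSpectralMap k N μ) = μ) ∧
    Set.BijOn (BandedSpectral.spectralMap hkN)
      (BandedSpectral.bandedClass k N) (BandedSpectral.measureClass k N) ∧
    Set.InvOn (BandedSpectral.inverseSpectralMap k N) (BandedSpectral.spectralMap hkN)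
      (BandedSpectral.bandedClass k N) (BandedSpectral.measureClass k N) := by
  open BandedSpectral in
  -- Existence and uniqueness are proved for measures of the form `φ(J)`; by `hsurj` these are all
  -- of `ℳ`.
  have hrec : ∀ J ∈ bandedClass k N,
      IsRecurrenceMatrix k N (spectralMap hkN J) J ∧
      ∀ J', IsRecurrenceMatrix k N (spectralMap hkN J) J' → J' = J := by
    rintro J ⟨A, B, hA, hB, hBu, hBe, rfl⟩
    have hmod := isModel_spectralMap hkN (blockTridiag_isHermitian (B := B) hA)
    refine ⟨⟨_, A, B, isNormalizedOPS_recPoly hk hkN hmod hB hBu hBe, rfl⟩, ?_⟩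
    rintro J' ⟨P, A', B', h, rfl⟩
    exact h.blockTridiag_eq hk hkN hmod hB hBu hBe
  have hmaps : ∀ J ∈ BandedSpectral.bandedClass k N,
      BandedSpectral.spectralMap hkN J ∈ BandedSpectral.measureClass k N := by
    rintro J ⟨A, B, hA, hB, -, -, rfl⟩
    exact BandedSpectral.spectralMap_mem_measureClass hk hkN hA hB
  have hsurj : ∀ μ ∈ BandedSpectral.measureClass k N, ∃ J ∈ BandedSpectral.bandedClass k N,
      BandedSpectral.spectralMap hkN J = μ := fun μ hμ =>
    BandedSpectral.exists_mem_bandedClass_spectralMap_eq hk hkN hμ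
  -- The value chosen by `ψ` is some recurrence matrix of `φ(J)`, and `J` is the only one.
  have hleft : ∀ J ∈ BandedSpectral.bandedClass k N,
      BandedSpectral.inverseSpectralMap k N (BandedSpectral.spectralMap hkN J) = J := fun J hJ =>
    (hrec J hJ).2 _ (Classical.epsilon_spec ⟨J, (hrec J hJ).1⟩)
  refine ⟨?_, ?_, ⟨hmaps, ?_, hsurj⟩, hleft, ?_⟩
  · intro μ hμ
    obtain ⟨J, hJ, rfl⟩ := hsurj μ hμ
    exact ⟨J, (hrec J hJ).1, (hrec J hJ).2⟩
  · intro μ hμ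
    obtain ⟨J, hJ, rfl⟩ := hsurj μ hμ
    rw [hleft J hJ]
    exact ⟨hJ, rfl⟩
  · intro J hJ J' hJ' h
    rw [← hleft J hJ, h, hleft J' hJ']
  · intro μ hμ
    obtain ⟨J, hJ, rfl⟩ := hsurj μ hμ
    rw [hleft J hJ]
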